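/- Definitions (the game Bus Out). Colors are natural numbers. A configuration with $s$ parking spots is a triple $(G,Q,S)$, where the congestion graph $G$ is a finite directed graph whose vertices (buses) are labeled by pairs (color, capacity) with capacity a positive integer, the passenger queue $Q$ is a finite sequence of colors, and $S$ gives for each of the $s$ spots either $\varepsilon$ (empty) or a pair $(x,k)$ (a bus of color $x$ with $k\ge 1$ remaining seats). A bus is free if it has out-degree zero in $G$. There are two kinds of transitions. (i) Dispatching: a free vertex labeled $(x,k)$ is deleted from $G$, and one entry $\varepsilon$ of $S$ is replaced by $(x,k)$. (ii) Boarding: the first passenger $x$ of $Q$ is removed, and one entry $(x,k+1)$ of $S$ with $k\ge1$ is replaced by $(x,k)$, or one entry $(x,1)$ is replaced by $\varepsilon$. Boarding is automatic: a transition of type (i) is allowed only if none of type (ii) is possible. A configuration is solvable if some sequence of transitions leads from it to the empty configuration ($G$ and $Q$ empty, all spots empty). It is eligible if $G$ is acyclic and for every color the total number of seats of the buses of this color (capacities in $G$, remaining seats in $S$) equals the number of passengers of this color. For positive integers $s,c$ and nonempty $V\subseteq\mathbb N_+$, let $\mathcal B_{\mathrm{ind}}(s,c,V)$ be the class of configurations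 with $s$ spots, at most $c$ distinct colors, all bus capacities in $V$, and a congestion graph without edges. For a class $\mathcal B$ of configurations, $\mathbf{BusOut}(\mathcal B)$ is the problem of deciding whether a given eligible configuration of $\mathcal B$, all of whose parking spots are empty, is solvable. The input lists the buses, the edges, the queue passenger by passenger, and the spots; numbers are written in binary. Theorem. Fix positive integers $s$, $c$ and $v$, and let $\mathcal A(s,c,v)=\bigcup_{|V|\le v}\mathcal B_{\mathrm{ind}}(s,c,V)$, where $V$ ranges over the nonempty subsets of $\mathbb N_+$ with at most $v$ elements. The problem $\mathbf{BusOut}(\mathcal A(s,c,v))$ is decidable in polynomial time (by a multi-tape Turing machine that may depend on $s,c,v$). Moreover, there is a constant $K$ depending only on $s,c,v$ such that for every instance of $\mathbf{BusOut}(\mathcal A(s,c,v))$ with $n\ge 1$ passengers, at most $K\,n^{scv}$ configurations are reachable, where configurations that differ by an isomorphism of labeled congestion graphs are identified. -/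

import Mathlib

namespace BusOut

/-- Colors are natural numbers. -/
abbrev Color : Type := ℕ

/-- A bus: its color and its capacity (in the traffic) or its number of remaining seats
(at the station). -/
abbrev Bus : Type := Color × ℕ+

/-- A congestion graph with `m` buses: a directed graph on `Fin m` whose vertices are labeled
by a color and a capacity; `edge u w = true` means that there is a directed edge from `u` to `w`. -/
@[ext]
structure CongestionGraph (m : ℕ) where
  label : Fin m → Bus
  edge : Fin m → Fin m → Bool

namespace CongestionGraph

/-- A vertex is free if its out-degree is zero. -/
def Free {m : ℕ} (G : CongestionGraph m) (u : Fin m) : Prop :=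
  ∀ w, G.edge u w = false

/-- The graph has no directed cycle. -/
def Acyclic {m : ℕ} (G : CongestionGraph m) : Prop :=
  ∀ u, ¬ Relation.TransGen (fun a b => G.edge a b = true) u u

/-- `G` minus the vertex `u` (`u.succAbove` enumerates the other vertices). -/
def remove {m : ℕ} (G : CongestionGraph (m + 1)) (u : Fin (m + 1)) : CongestionGraph m where
  label i := G.label (u.succAbove i)
  edge i j := G.edge (u.succAbove i) (u.succAbove j)

end CongestionGraph

/-- The state of the `s` parking spots: `none` is an empty spot, and `some (x, k)` is a spot with
a bus of color `x` and `k` remaining seats. -/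
abbrev SpotState (s : ℕ) : Type := Fin s → Option Bus

/-- A configuration: a congestion graph, a passenger queue (its head boards first), and the state
of the `s` parking spots. -/
@[ext]
structure Config (s : ℕ) where
  size : ℕ
  graph : CongestionGraph size
  queue : List Color
  spots : SpotState s

/-- The first passenger of the queue finds a parked bus of the matching color. -/
def CanBoard {s : ℕ} (Q : List Color) (S : SpotState s) : Prop :=
  ∃ x ∈ Q.head?, ∃ i k, S i = some (x, k)

/-- The transitions. A free bus may be dispatched to an empty spot; passengers board automatically,
so a bus can be dispatched only when no boarding is possible. -/
inductive Step {s : ℕ} : Config s → Config s → Prop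
  | dispatch {m : ℕ} (G : CongestionGraph (m + 1)) (Q : List Color) (S : SpotState s)
      (u : Fin (m + 1)) (i : Fin s) (hfree : G.Free u) (hspot : S i = none)
      (hwait : ¬ CanBoard Q S) :
      Step ⟨m + 1, G, Q, S⟩ ⟨m, G.remove u, Q, Function.update S i (some (G.label u))⟩
  | board {m : ℕ} (G : CongestionGraph m) (x : Color) (Q : List Color) (S : SpotState s)
      (i : Fin s) (k : ℕ+) (hspot : S i = some (x, k + 1)) :
      Step ⟨m, G, x :: Q, S⟩ ⟨m, G, Q, Function.update S i (some (x, k))⟩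
  | boardLast {m : ℕ} (G : CongestionGraph m) (x : Color) (Q : List Color) (S : SpotState s)
      (i : Fin s) (hspot : S i = some (x, 1)) :
      Step ⟨m, G, x :: Q, S⟩ ⟨m, G, Q, Function.update S i none⟩

namespace Config

/-- The empty configuration: no bus in the traffic, no passenger, no bus at the station. -/
def IsEmpty {s : ℕ} (C : Config s) : Prop :=
  C.size = 0 ∧ C.queue = [] ∧ ∀ i, C.spots i = none

/-- `D` is reachable from `C` by a (possibly empty) sequence of transitions. -/
def Reaches {s : ℕ} (C D : Config s) : Prop :=
  Relation.ReflTransGen Step C D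

def Solvable {s : ℕ} (C : Config s) : Prop :=
  ∃ D, C.Reaches D ∧ D.IsEmpty

/-- The total number of seats available for the passengers of color `x`. -/
def seats {s : ℕ} (C : Config s) (x : Color) : ℕ :=
  (∑ u, if (C.graph.label u).1 = x then ((C.graph.label u).2 : ℕ) else 0) +
    ∑ i, (C.spots i).elim 0 fun b => if b.1 = x then (b.2 : ℕ) else 0

/-- Eligible configurations: the congestion graph has no cycle, and for each color the total
capacity of the buses equals the number of passengers. -/
def Eligible {s : ℕ} (C : Config s) : Prop :=
  C.graph.Acyclic ∧ ∀ x, C.seats x = C.queue.count x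

/-- All parking spots are empty. -/
def SpotsEmpty {s : ℕ} (C : Config s) : Prop :=
  ∀ i, C.spots i = none

/-- The colors that occur on buses or passengers. -/
def colors {s : ℕ} (C : Config s) : Set Color :=
  {x | x ∈ C.queue ∨ (∃ u, (C.graph.label u).1 = x) ∨ ∃ i k, C.spots i = some (x, k)}

/-- Two configurations are the same up to an isomorphism of their labeled congestion graphs. -/
def Iso {s : ℕ} (C D : Config s) : Prop :=
  (∃ e : Fin C.size ≃ Fin D.size,
    (∀ u, D.graph.label (e u) = C.graph.label u) ∧
    ∀ u w, D.graph.edge (e u) (e w) = C.graph.edge u w) ∧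
  C.queue = D.queue ∧ C.spots = D.spots

theorem iso_equivalence (s : ℕ) : Equivalence (Iso (s := s)) where
  refl _ := ⟨⟨Equiv.refl _, fun _ => rfl, fun _ _ => rfl⟩, rfl, rfl⟩
  symm := by
    rintro C D ⟨⟨e, hl, he⟩, hq, hs⟩
    refine ⟨⟨e.symm, fun u => ?_, fun u w => ?_⟩, hq.symm, hs.symm⟩
    · simpa using (hl (e.symm u)).symm
    · simpa using (he (e.symm u) (e.symm w)).symm
  trans := by
    rintro C D E ⟨⟨e, hl, he⟩, hq, hs⟩ ⟨⟨f, hm, hf⟩, hr, ht⟩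
    refine ⟨⟨e.trans f, fun u => ?_, fun u w => ?_⟩, hq.trans hr, hs.trans ht⟩
    · simp [hl, hm]
    · simp [he, hf]

/-- Configurations up to isomorphism of the congestion graph. -/
def isoSetoid (s : ℕ) : Setoid (Config s) := ⟨Iso, iso_equivalence s⟩

/-- The set of isomorphism classes of the configurations reachable from `C`. -/
def reachableClasses {s : ℕ} (C : Config s) : Set (Quotient (isoSetoid s)) :=
  Quotient.mk (isoSetoid s) '' {D | C.Reaches D}

end Config

/-! ### Classes of configurations -/

/-- At most `c` colors are used, and the capacities of the buses belong to `V`. -/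
def classB (s c : ℕ) (V : Set ℕ+) : Set (Config s) :=
  {C | C.colors.encard ≤ c ∧ ∀ u, (C.graph.label u).2 ∈ V}

/-- The configurations of `classB s c V` whose congestion graph has no edge. -/
def classBind (s c : ℕ) (V : Set ℕ+) : Set (Config s) :=
  {C | C ∈ classB s c V ∧ ∀ u w, C.graph.edge u w = false}

/-- The union of the classes `classBind s c V` over all nonempty `V` with at most `v` elements. -/
def classA (s c v : ℕ) : Set (Config s) :=
  ⋃ V ∈ {V : Set ℕ+ | V.Nonempty ∧ V.encard ≤ v}, classBind s c V

/-- The instances of the problem for a class `B` of configurations: the eligible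
configurations of the class in which all parking spots are empty. -/
abbrev Instance {s : ℕ} (B : Set (Config s)) : Type :=
  {C : Config s // C ∈ B ∧ C.Eligible ∧ C.SpotsEmpty}

/-! ### Encoding of configurations as strings -/

/-- A number in binary, closed by a comma. -/
def encNat (n : ℕ) : List Computability.Γ' :=
  (Computability.encodeNat n).map Computability.Γ'.bit ++ [Computability.Γ'.comma]

/-- A bus: its color and its capacity. -/
def encBus (b : Bus) : List Computability.Γ' :=
  encNat b.1 ++ encNat b.2

/-- A directed edge: its two end points. -/
def encEdge {m : ℕ} (p : Fin m × Fin m) : List Computability.Γ' :=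
  encNat p.1 ++ encNat p.2

/-- A parking spot. -/
def encSpot : Option Bus → List Computability.Γ'
  | none => [Computability.Γ'.blank]
  | some b => Computability.Γ'.bra :: encBus b

/-- A list: each entry is preceded by an opening bracket, and a closing bracket ends the list. -/
def encList {α : Type} (f : α → List Computability.Γ') : List α → List Computability.Γ'
  | [] => [Computability.Γ'.ket]
  | a :: l => Computability.Γ'.bra :: (f a ++ encList f l)

/-- The list of the edges of a congestion graph. -/
def CongestionGraph.edgeList {m : ℕ} (G : CongestionGraph m) : List (Fin m × Fin m) :=
  (List.finRange m ×ˢ List.finRange m).filter fun p => G.edge p.1 p.2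

/-- The encoding of a configuration: the list of the buses, the list of the edges, the queue
written out passenger by passenger, and the list of the parking spots. -/
def Config.encode {s : ℕ} (C : Config s) : List Computability.Γ' :=
  encList encBus (List.ofFn C.graph.label) ++ (encList encEdge C.graph.edgeList ++
    (encList encNat C.queue ++ encList encSpot (List.ofFn C.spots)))

/-! The encoding is injective. -/

theorem encNat_prefix (a b : ℕ) (r t : List Computability.Γ') (h : encNat a ++ r = encNat b ++ t) :
    a = b ∧ r = t := by
  have key : ∀ l l' : List Bool,
      l.map Computability.Γ'.bit ++ Computability.Γ'.comma :: r =
        l'.map Computability.Γ'.bit ++ Computability.Γ'.comma :: t → l = l' ∧ r = t := by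
    intro l
    induction l with
    | nil => intro l' h; cases l' <;> simp_all
    | cons x l ih =>
      intro l' h
      cases l' with
      | nil => simp at h
      | cons y l' =>
        simp only [List.map_cons, List.cons_append, List.cons.injEq,
          Computability.Γ'.bit.injEq] at h
        obtain ⟨h1, h2⟩ := ih l' h.2
        exact ⟨by rw [h.1, h1], h2⟩
  obtain ⟨h1, h2⟩ := key _ _ (by simpa [encNat] using h)
  refine ⟨?_, h2⟩
  rw [← Computability.decode_encodeNat a, h1, Computability.decode_encodeNat]

theorem encBus_prefix (a b : Bus) (r t : List Computability.Γ') (h : encBus a ++ r = encBus b ++ t) :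
    a = b ∧ r = t := by
  simp only [encBus, List.append_assoc] at h
  obtain ⟨h1, h2⟩ := encNat_prefix _ _ _ _ h
  obtain ⟨h3, h4⟩ := encNat_prefix _ _ _ _ h2
  exact ⟨Prod.ext h1 (PNat.coe_injective h3), h4⟩

theorem encEdge_prefix {m : ℕ} (a b : Fin m × Fin m) (r t : List Computability.Γ')
    (h : encEdge a ++ r = encEdge b ++ t) : a = b ∧ r = t := by
  simp only [encEdge, List.append_assoc] at h
  obtain ⟨h1, h2⟩ := encNat_prefix _ _ _ _ h
  obtain ⟨h3, h4⟩ := encNat_prefix _ _ _ _ h2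
  exact ⟨Prod.ext (Fin.ext h1) (Fin.ext h3), h4⟩

theorem encSpot_prefix (a b : Option Bus) (r t : List Computability.Γ')
    (h : encSpot a ++ r = encSpot b ++ t) : a = b ∧ r = t := by
  cases a <;> cases b <;> simp [encSpot] at h
  · exact ⟨rfl, h⟩
  · obtain ⟨h1, h2⟩ := encBus_prefix _ _ _ _ h
    exact ⟨by rw [h1], h2⟩

theorem encList_prefix {α : Type} (f : α → List Computability.Γ')
    (hf : ∀ a b r t, f a ++ r = f b ++ t → a = b ∧ r = t) (l l' : List α)
    (r t : List Computability.Γ') (h : encList f l ++ r = encList f l' ++ t) :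
    l = l' ∧ r = t := by
  induction l generalizing l' with
  | nil => cases l' <;> simp_all [encList]
  | cons a l ih =>
    cases l' with
    | nil => simp [encList] at h
    | cons b l' =>
      simp only [encList, List.cons_append, List.append_assoc, List.cons.injEq, true_and] at h
      obtain ⟨h1, h2⟩ := hf _ _ _ _ h
      obtain ⟨h3, h4⟩ := ih _ h2
      exact ⟨by rw [h1, h3], h4⟩

theorem Config.encode_injective {s : ℕ} : Function.Injective (Config.encode (s := s)) := by
  rintro ⟨m, ⟨l, E⟩, Q, S⟩ ⟨m', ⟨l', E'⟩, Q', S'⟩ h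
  simp only [Config.encode] at h
  obtain ⟨h1, h⟩ := encList_prefix _ encBus_prefix _ _ _ _ h
  obtain rfl : m = m' := by simpa using congrArg List.length h1
  obtain ⟨h2, h⟩ := encList_prefix _ encEdge_prefix _ _ _ _ h
  obtain ⟨h3, h⟩ := encList_prefix _ encNat_prefix _ _ _ _ h
  obtain ⟨h4, -⟩ := encList_prefix _ encSpot_prefix _ _ [] [] (by simpa using h)
  obtain rfl := List.ofFn_injective h1
  obtain rfl := List.ofFn_injective h4
  obtain rfl : E = E' := by
    funext a b
    have := congrArg (fun L => (a, b) ∈ L) h2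
    simp only [CongestionGraph.edgeList, List.mem_filter, List.mem_product, List.mem_finRange,
      true_and, eq_iff_iff] at this
    exact Bool.eq_iff_iff.mpr this
  simp_all

/-! ### Polynomial time -/

/-- The decision problem `P`, whose instances `a : α` are written as strings `enc a`, is decidable
in polynomial time: some (multi-tape) Turing machine answers `P a` correctly on the input `enc a`,
for every instance `a`, within a number of steps that is polynomial in the length of the input. -/
def DecidableInPolyTime {α Γ : Type} (enc : α → List Γ) (P : α → Prop) : Prop :=
  ∃ f : α → Bool, (∀ a, f a = true ↔ P a) ∧
    Nonempty (Turing.TM2ComputableInPolyTime enc Computability.encodeBool f)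

end BusOut

/-! Counting. Eligibility with empty spots says that the total number of seats equals the queue
length. Every transition preserves this equality, and the queue is always a suffix of the initial
one; hence the traffic and the spots determine the queue (`Config.Below`, `Config.Below.queue_eq`).
Without edges, a reachable configuration is thus known up to isomorphism from the multiset of labels
in the traffic and the spots. There are at most `c * v` labels; if a label has multiplicity `f` and
capacity `g`, then `f * g ≤ n`. The submultisets number the product of the `f + 1`, and a spot has
at most one more state than the sum of the `g`. Bounding all factors separately would give the
exponent `s + c * v`, too large if `s = 1` or `c * v = 1`. One power is saved at the label of
largest capacity, where `(f + 1) * g ≤ 2 * n`; and `s + c * v - 1 ≤ s * c * v`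
(`prod_succ_mul_pow_le`).

Algorithm. Each transition lowers the number of buses in the traffic plus the number of passengers
by one. A breadth-first search therefore has a number of levels known in advance, and solvability
means that its last level is nonempty (`solvable_iff_levels`). The counting bounds every level,
provided that equal multisets of buses are stored as equal lists (`ErasedFrom.eq_of_perm`). Colors
stay binary words, whereas capacities are converted to unary; this is harmless because no capacity
exceeds the number of passengers, who are listed one by one in the input.

Machine. A small structured language is compiled to stack machines (`Prog.stmt_correct`). Its values
are binary trees in prefix code. The functions in `PolyTime` are closed under composition, pairing,
case distinction and folds with polynomially bounded accumulators (`PolyTime.foldl_mem`), and the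
search is written in these terms. `decidableInPolyTime_of_polyTime` leads back to the machine. -/

namespace BusOut

open Computability Turing

/-! ### A structured programming language for machines with several stacks -/

/-- The stacks: a data stack, three auxiliary stacks and an output stack. -/
inductive Stk
  | d | a | b | c | o
  deriving DecidableEq

instance : Fintype Stk := ⟨{.d, .a, .b, .c, .o}, fun k => by cases k <;> simp⟩

/-- The alphabets of the stacks. -/
def Sym : Stk → Type
  | .o => Bool
  | _ => Γ'

/-- The local variables of a program: two registers for symbols. -/
abbrev Reg : Type := Option Γ' × Option Γ'

/-- The contents of the stacks. -/
abbrev Mem : Type := ∀ k, List (Sym k)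

/-- Structured programs. -/
inductive Prog : Type
  | push (k : Stk) (f : Reg → Sym k)
  | pop (k : Stk) (f : Reg → Option (Sym k) → Reg)
  | load (f : Reg → Reg)
  | seq (p q : Prog)
  | ite (t : Reg → Bool) (p q : Prog)
  | loop (t : Reg → Bool) (p : Prog)

infixr:60 " ;; " => Prog.seq

/-- `Exec p x n y`: started in the state `x`, the program `p` stops in the state `y` after `n`
steps. -/
inductive Exec : Prog → Reg × Mem → ℕ → Reg × Mem → Prop
  | push (k f v S) : Exec (.push k f) (v, S) 1 (v, Function.update S k (f v :: S k))
  | pop (k f v S) :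
      Exec (.pop k f) (v, S) 1 (f v (S k).head?, Function.update S k (S k).tail)
  | load (f v S) : Exec (.load f) (v, S) 1 (f v, S)
  | seq {p q x y z m n} : Exec p x m y → Exec q y n z → Exec (.seq p q) x (m + n) z
  | ite_true {t p q x y n} : t x.1 = true → Exec p x n y → Exec (.ite t p q) x (n + 1) y
  | ite_false {t p q x y n} : t x.1 = false → Exec q x n y → Exec (.ite t p q) x (n + 1) y
  | loop_exit {t p x} : t x.1 = false → Exec (.loop t p) x 1 x
  | loop_step {t p x y z m n} : t x.1 = true → Exec p x m y → Exec (.loop t p) y n z →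
      Exec (.loop t p) x (m + n + 1) z

namespace Prog

/-- The labels of the machine that runs a program. -/
def Lab : Prog → Type
  | seq p q => Lab p ⊕ Lab q
  | ite _ p q => Option (Lab p ⊕ Lab q)
  | loop _ p => Option (Lab p)
  | _ => Unit

instance Lab.fintype : ∀ p : Prog, Fintype (Lab p)
  | push _ _ => inferInstanceAs (Fintype Unit)
  | pop _ _ => inferInstanceAs (Fintype Unit)
  | load _ => inferInstanceAs (Fintype Unit)
  | seq p q =>
    letI := Lab.fintype p
    letI := Lab.fintype q
    inferInstanceAs (Fintype (Lab p ⊕ Lab q))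
  | ite _ p q =>
    letI := Lab.fintype p
    letI := Lab.fintype q
    inferInstanceAs (Fintype (Option (Lab p ⊕ Lab q)))
  | loop _ p =>
    letI := Lab.fintype p
    inferInstanceAs (Fintype (Option (Lab p)))

/-- The label where a program starts. -/
def entry : ∀ p : Prog, Lab p
  | push _ _ => ()
  | pop _ _ => ()
  | load _ => ()
  | seq p _ => Sum.inl (entry p)
  | ite _ _ _ => none
  | loop _ _ => none

/-- The statements of the machine that runs a program; `e` embeds the labels of the program in
those of the machine, and `x` is the label to continue with. -/
def stmt {L : Type} : ∀ p : Prog, (Lab p → L) → L → Lab p → TM2.Stmt Sym L Reg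
  | push k f, _, x, _ => .push k f (.goto fun _ => x)
  | pop k f, _, x, _ => .pop k f (.goto fun _ => x)
  | load f, _, x, _ => .load f (.goto fun _ => x)
  | seq p q, e, _, Sum.inl l => stmt p (fun i => e (Sum.inl i)) (e (Sum.inr (entry q))) l
  | seq _ q, e, x, Sum.inr l => stmt q (fun i => e (Sum.inr i)) x l
  | ite t p q, e, _, none => .branch t (.goto fun _ => e (some (Sum.inl (entry p))))
      (.goto fun _ => e (some (Sum.inr (entry q))))
  | ite _ p _, e, x, some (Sum.inl l) => stmt p (fun i => e (some (Sum.inl i))) x l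
  | ite _ _ q, e, x, some (Sum.inr l) => stmt q (fun i => e (some (Sum.inr i))) x l
  | loop t p, e, x, none => .branch t (.goto fun _ => e (some (entry p))) (.goto fun _ => x)
  | loop _ p, e, _, some l => stmt p (fun i => e (some i)) (e none) l

theorem iterate_bind_add {σ : Type} (f : σ → Option σ) {x y : σ} {z : Option σ} {m n : ℕ}
    (h₁ : (flip bind f)^[m] (some x) = some y) (h₂ : (flip bind f)^[n] (some y) = z) :
    (flip bind f)^[m + n] (some x) = z := by
  rw [Nat.add_comm, Function.iterate_add_apply, h₁, h₂]

/-- The machine is only required to agree with `stmt` on the image of `e`, so the induction passes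
to subprograms with a restricted embedding. Sequencing costs no step, since each statement jumps
directly to the entry of what follows; a test costs one. -/
theorem stmt_correct {L : Type} (M : L → TM2.Stmt Sym L Reg) {p : Prog} {x y : Reg × Mem} {n : ℕ}
    (h : Exec p x n y) : ∀ (e : Lab p → L) (l : L), (∀ i, M (e i) = stmt p e l i) →
      (flip bind (TM2.step M))^[n] (some ⟨some (e (entry p)), x.1, x.2⟩) =
        some ⟨some l, y.1, y.2⟩ := by
  have one : ∀ (l l' : L) (v v' : Reg) (S S' : Mem),
      TM2.stepAux (M l) v S = ⟨some l', v', S'⟩ →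
      (flip bind (TM2.step M))^[1] (some ⟨some l, v, S⟩) = some ⟨some l', v', S'⟩ := by
    intro l l' v v' S S' h
    simp [flip, TM2.step, h]
  induction h with
  | push k f v S => intro e l h; exact one _ _ _ _ _ _ (by rw [h]; rfl)
  | pop k f v S => intro e l h; exact one _ _ _ _ _ _ (by rw [h]; rfl)
  | load f v S => intro e l h; exact one _ _ _ _ _ _ (by rw [h]; rfl)
  | seq _ _ ih₁ ih₂ =>
    intro e l h
    exact iterate_bind_add _ (ih₁ (fun i => e (Sum.inl i)) _ fun i => h (Sum.inl i))
      (ih₂ (fun i => e (Sum.inr i)) l fun i => h (Sum.inr i))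
  | @ite_true t p q x y n ht _ ih =>
    intro e l h
    rw [Nat.add_comm]
    refine iterate_bind_add _ (one _ (e (some (Sum.inl (entry p)))) _ x.1 _ x.2 ?_)
      (ih (fun i => e (some (Sum.inl i))) l fun i => h (some (Sum.inl i)))
    rw [h]
    simp [stmt, entry, TM2.stepAux, ht]
  | @ite_false t p q x y n ht _ ih =>
    intro e l h
    rw [Nat.add_comm]
    refine iterate_bind_add _ (one _ (e (some (Sum.inr (entry q)))) _ x.1 _ x.2 ?_)
      (ih (fun i => e (some (Sum.inr i))) l fun i => h (some (Sum.inr i)))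
    rw [h]
    simp [stmt, entry, TM2.stepAux, ht]
  | @loop_exit t p x ht =>
    intro e l h
    refine one _ _ _ _ _ _ ?_
    rw [h]
    simp [stmt, entry, TM2.stepAux, ht]
  | @loop_step t p x y z m n ht _ _ ih₁ ih₂ =>
    intro e l h
    rw [Nat.add_comm]
    refine iterate_bind_add _ (one _ (e (some (entry p))) _ x.1 _ x.2 ?_)
      (iterate_bind_add _ (ih₁ (fun i => e (some i)) _ fun i => h (some i)) (ih₂ e l h))
    rw [h]
    simp [stmt, entry, TM2.stepAux, ht]

end Prog

/-- The memory with given contents. -/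
def mem (d a b c : List Γ') (o : List Bool) : Mem
  | .d => d
  | .a => a
  | .b => b
  | .c => c
  | .o => o

section
variable (d a b c : List Γ') (o : List Bool)

@[simp] theorem mem_d : mem d a b c o .d = d := rfl

@[simp] theorem update_mem_d (x : List Γ') :
    Function.update (mem d a b c o) .d x = mem x a b c o := by funext k; cases k <;> rfl
@[simp] theorem update_mem_a (x : List Γ') :
    Function.update (mem d a b c o) .a x = mem d x b c o := by funext k; cases k <;> rfl
@[simp] theorem update_mem_b (x : List Γ') :
    Function.update (mem d a b c o) .b x = mem d a x c o := by funext k; cases k <;> rfl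
@[simp] theorem update_mem_c (x : List Γ') :
    Function.update (mem d a b c o) .c x = mem d a b x o := by funext k; cases k <;> rfl
@[simp] theorem update_mem_o (x : List Bool) :
    Function.update (mem d a b c o) .o x = mem d a b c x := by funext k; cases k <;> rfl

end

/-- The machine that runs a program, with the given input stack. The output is written to `o`. -/
def Prog.machine (p : Prog) : FinTM2 where
  K := Stk
  k₀ := .a
  k₁ := .o
  Γ := Sym
  Λ := Option p.Lab
  main := some p.entry
  σ := Reg
  initialState := (none, none)
  Γk₀Fin := inferInstanceAs (Fintype Γ')
  m
    | none => .halt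
    | some l => p.stmt some none l

/-- The step added to `T` is the halting step at the label `none`. A halting configuration must have
initial registers and no contents except the output, hence the final state demanded of `p`. -/
theorem decidableInPolyTime_of_exec {α : Type} (enc : α → List Γ') (P : α → Prop) (f : α → Bool)
    (hf : ∀ x, f x = true ↔ P x) (p : Prog) (T : Polynomial ℕ)
    (h : ∀ x, ∃ n ≤ T.eval (enc x).length, Exec p ((none, none), mem [] (enc x) [] [] []) n
      ((none, none), mem [] [] [] [] [f x])) : DecidableInPolyTime enc P := by
  refine ⟨f, hf, ⟨?_⟩⟩
  choose n hn he using h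
  refine ⟨⟨p.machine, Equiv.refl _, Equiv.refl _⟩, T + 1, fun x => ⟨⟨n x + 1, ?_⟩, ?_⟩⟩
  · refine Prog.iterate_bind_add (y := ⟨some none, (none, none), mem [] [] [] [] [f x]⟩)
      p.machine.step (Eq.trans ?_
        (Prog.stmt_correct p.machine.m (he x) some none fun _ => rfl)) ?_
    · congr 2
      simp only [initList]
      congr 1
      funext k
      cases k <;> first | rfl | exact List.map_id _
    · simp only [flip, FinTM2.step, Function.iterate_one]
      refine congrArg some ?_
      change (⟨none, (none, none), mem [] [] [] [] [f x]⟩ : p.machine.Cfg) = _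
      simp only [haltList]
      congr 1
      funext k
      cases k <;> rfl
  · simpa using hn x

end BusOut

namespace BusOut

open Computability Turing

/-! ### Runs of programs with time bounds -/

/-- The program `p` leads from the state `x` to the state `y` in at most `N` steps. -/
def Runs (p : Prog) (x y : Reg × Mem) (N : ℕ) : Prop :=
  ∃ n ≤ N, Exec p x n y

namespace Runs

variable {p q : Prog} {t : Reg → Bool} {x y z : Reg × Mem} {m n : ℕ}

theorem mono (h : Runs p x y m) (hmn : m ≤ n) : Runs p x y n :=
  let ⟨k, hk, he⟩ := h
  ⟨k, hk.trans hmn, he⟩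

theorem seq (hp : Runs p x y m) (hq : Runs q y z n) : Runs (p ;; q) x z (m + n) :=
  let ⟨_, hk, he⟩ := hp
  let ⟨_, hl, hf⟩ := hq
  ⟨_, add_le_add hk hl, .seq he hf⟩

theorem ite_true (ht : t x.1 = true) (h : Runs p x y n) : Runs (.ite t p q) x y (n + 1) :=
  let ⟨_, hk, he⟩ := h
  ⟨_, add_le_add hk le_rfl, .ite_true ht he⟩

theorem ite_false (ht : t x.1 = false) (h : Runs q x y n) : Runs (.ite t p q) x y (n + 1) :=
  let ⟨_, hk, he⟩ := h
  ⟨_, add_le_add hk le_rfl, .ite_false ht he⟩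

theorem loop_exit (ht : t x.1 = false) : Runs (.loop t p) x x 1 :=
  ⟨_, le_rfl, .loop_exit ht⟩

theorem loop_step (ht : t x.1 = true) (hp : Runs p x y m) (hl : Runs (.loop t p) y z n) :
    Runs (.loop t p) x z (m + n + 1) :=
  let ⟨_, hk, he⟩ := hp
  let ⟨_, hl, hf⟩ := hl
  ⟨_, by omega, .loop_step ht he hf⟩

theorem load (f : Reg → Reg) (v : Reg) (S : Mem) : Runs (.load f) (v, S) (f v, S) 1 :=
  ⟨_, le_rfl, .load _ _ _⟩

theorem push (k : Stk) (f : Reg → Sym k) (v : Reg) (S : Mem) {S' : Mem}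
    (h : Function.update S k (f v :: S k) = S') : Runs (.push k f) (v, S) (v, S') 1 :=
  ⟨1, le_rfl, h ▸ .push k f v S⟩

theorem pop (k : Stk) (f : Reg → Option (Sym k) → Reg) (v : Reg) (S : Mem) {S' : Mem}
    (h : Function.update S k (S k).tail = S') :
    Runs (.pop k f) (v, S) (f v (S k).head?, S') 1 :=
  ⟨1, le_rfl, h ▸ .pop k f v S⟩

variable (v : Reg) (d a b c : List Γ') (o : List Bool)

theorem push_d (f : Reg → Γ') :
    Runs (.push .d f) (v, mem d a b c o) (v, mem (f v :: d) a b c o) 1 :=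
  Runs.push _ _ _ _ (update_mem_d ..)

theorem push_a (f : Reg → Γ') :
    Runs (.push .a f) (v, mem d a b c o) (v, mem d (f v :: a) b c o) 1 :=
  Runs.push _ _ _ _ (update_mem_a ..)

theorem push_b (f : Reg → Γ') :
    Runs (.push .b f) (v, mem d a b c o) (v, mem d a (f v :: b) c o) 1 :=
  Runs.push _ _ _ _ (update_mem_b ..)

theorem push_c (f : Reg → Γ') :
    Runs (.push .c f) (v, mem d a b c o) (v, mem d a b (f v :: c) o) 1 :=
  Runs.push _ _ _ _ (update_mem_c ..)

theorem push_o (f : Reg → Bool) :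
    Runs (.push .o f) (v, mem d a b c o) (v, mem d a b c (f v :: o)) 1 :=
  Runs.push _ _ _ _ (update_mem_o ..)

theorem pop_d (f : Reg → Option Γ' → Reg) :
    Runs (.pop .d f) (v, mem d a b c o) (f v d.head?, mem d.tail a b c o) 1 :=
  Runs.pop _ _ _ _ (update_mem_d ..)

theorem pop_a (f : Reg → Option Γ' → Reg) :
    Runs (.pop .a f) (v, mem d a b c o) (f v a.head?, mem d a.tail b c o) 1 :=
  Runs.pop _ _ _ _ (update_mem_a ..)

theorem pop_b (f : Reg → Option Γ' → Reg) :
    Runs (.pop .b f) (v, mem d a b c o) (f v b.head?, mem d a b.tail c o) 1 :=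
  Runs.pop _ _ _ _ (update_mem_b ..)

theorem pop_c (f : Reg → Option Γ' → Reg) :
    Runs (.pop .c f) (v, mem d a b c o) (f v c.head?, mem d a b c.tail o) 1 :=
  Runs.pop _ _ _ _ (update_mem_c ..)

end Runs

/-! ### Trees -/

/-- Binary trees, the values of our programs. -/
inductive Data
  | nil
  | cons (x y : Data)
  deriving DecidableEq

/-- The prefix code of a tree. -/
def Data.code : Data → List Γ'
  | nil => [.bit false]
  | cons x y => .bit true :: (x.code ++ y.code)

/-- The size of a tree. -/
def Data.size (t : Data) : ℕ := t.code.length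

@[simp] theorem Data.size_nil : Data.nil.size = 1 := rfl

@[simp] theorem Data.size_cons (x y : Data) : (Data.cons x y).size = x.size + y.size + 1 := by
  simp [Data.size, Data.code]

theorem Data.size_pos (t : Data) : 0 < t.size := by cases t <;> simp

theorem Data.comma_notMem_code (t : Data) : Γ'.comma ∉ t.code := by
  induction t with
  | nil => simp [Data.code]
  | cons x y hx hy => simp [Data.code, hx, hy]

theorem Data.code_prefix : ∀ (x y : Data) (r t : List Γ'), x.code ++ r = y.code ++ t →
    x = y ∧ r = t := by
  intro x
  induction x with
  | nil => intro y r t h; cases y <;> simp_all [Data.code]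
  | cons x₁ x₂ h₁ h₂ =>
    intro y r t h
    cases y with
    | nil => simp [Data.code] at h
    | cons y₁ y₂ =>
      simp only [Data.code, List.cons_append, List.append_assoc, List.cons.injEq, true_and] at h
      obtain ⟨e₁, h⟩ := h₁ _ _ _ h
      obtain ⟨e₂, h⟩ := h₂ _ _ _ h
      exact ⟨by rw [e₁, e₂], h⟩

theorem Data.code_injective : Function.Injective Data.code := fun x y h =>
  (Data.code_prefix x y [] [] (by simpa using h)).1

namespace Prog

/-- Reset the registers. -/
def reset : Prog := .load fun _ => (none, none)

/-- Load the top of a stack into the first register and remove it. -/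
def popD : Prog := .pop .d fun v s => (s, v.2)
/-- Load the top of a stack into the first register and remove it. -/
def popA : Prog := .pop .a fun v s => (s, v.2)
/-- Load the top of a stack into the first register and remove it. -/
def popB : Prog := .pop .b fun v s => (s, v.2)
/-- Load the top of a stack into the first register and remove it. -/
def popC : Prog := .pop .c fun v s => (s, v.2)

/-- The symbol in the first register. -/
def sym (v : Reg) : Γ' := v.1.getD .blank

/-- Push the symbol in the first register. -/
def pushD : Prog := .push .d sym
/-- Push the symbol in the first register. -/
def pushA : Prog := .push .a sym
/-- Push the symbol in the first register. -/
def pushB : Prog := .push .b sym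

/-- Move the symbols up to the first comma; the program `pop` reads and the program `push`
writes. -/
def transfer (pop push : Prog) : Prog :=
  pop ;; .loop (fun v => v.1 != some .comma) (push ;; pop) ;; reset

/-- One symbol is read ahead, so the comma is consumed but not written. `F` presents the memory as a
function of source and target, so that one proof serves all choices of stacks, including the double
target in `dup`. -/
theorem transfer_runs {pop push : Prog} {N : ℕ} (F : List Γ' → List Γ' → Mem)
    (hpop : ∀ v x w u, Runs pop (v, F (x :: w) u) ((some x, v.2), F w u) 1)
    (hpush : ∀ v x w u, Runs push ((some x, v), F w u) ((some x, v), F w (x :: u)) N)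
    (w : List Γ') (hw : Γ'.comma ∉ w) (r u : List Γ') :
    Runs (transfer pop push) ((none, none), F (w ++ .comma :: r) u)
      ((none, none), F r (w.reverse ++ u)) ((N + 2) * w.length + 3) := by
  have key : ∀ (w : List Γ') (x : Γ'), x ≠ .comma → Γ'.comma ∉ w → ∀ u,
      Runs (.loop (fun v => v.1 != some .comma) (push ;; pop))
        ((some x, none), F (w ++ .comma :: r) u)
        ((some .comma, none), F r ((x :: w).reverse ++ u)) ((N + 2) * (w.length + 1) + 1) := by
    intro w
    induction w with
    | nil =>
      intro x hx hw u
      refine (Runs.loop_step (by simpa using hx) ((hpush _ _ _ _).seq (hpop _ _ _ _))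
        (Runs.loop_exit (by simp))).mono ?_
      simp
    | cons y w ih =>
      intro x hx hw u
      simp only [List.mem_cons, not_or] at hw
      refine (Runs.loop_step (by simpa using hx) ((hpush _ _ _ _).seq (hpop _ _ _ _))
        (by simpa using ih y (Ne.symm hw.1) hw.2 (x :: u))).mono ?_
      simp only [List.length_cons]; ring_nf; omega
  cases w with
  | nil =>
    refine ((hpop _ _ _ _).seq ((Runs.loop_exit (by simp)).seq (Runs.load _ _ _))).mono ?_
    simp
  | cons x w =>
    simp only [List.mem_cons, not_or] at hw
    refine ((hpop _ _ _ _).seq ((key w x (Ne.symm hw.1) hw.2 u).seq (Runs.load _ _ _))).mono ?_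
    simp only [List.length_cons]; omega

/-- Move the tree on top of the data stack; the program `mark` writes a comma and the program
`push` writes the symbols. The stack `c` holds one symbol for each further subtree to come. -/
def moveTo (mark push : Prog) : Prog :=
  mark ;; .load (fun _ => (some .comma, none)) ;;
    .loop (fun v => v.1.isSome)
      (popD ;; push ;;
        .ite (fun v => v.1 == some (.bit true))
          (.push .c (fun _ => .comma) ;; .push .c (fun _ => .comma) ;; popC) popC) ;; reset

/-- A prefix code ends when no subtree is left to come. The number of subtrees to come is the length
of `c` plus one for a filled register: a node pushes two commas, and every symbol pops one into the
register, which becomes empty after the last leaf. -/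
theorem moveTo_runs {mark push : Prog} (F : List Γ' → List Γ' → List Γ' → Mem)
    (hd : ∀ v x d u c, Runs popD (v, F (x :: d) u c) ((some x, v.2), F d u c) 1)
    (hc : ∀ v d u c, Runs popC (v, F d u c) ((c.head?, v.2), F d u c.tail) 1)
    (hc' : ∀ v d u c, Runs (.push .c fun _ => .comma) (v, F d u c) (v, F d u (.comma :: c)) 1)
    (hmark : ∀ v d u c, Runs mark (v, F d u c) (v, F d (.comma :: u) c) 1)
    (hpush : ∀ v x d u c, Runs push ((some x, v), F d u c) ((some x, v), F d (x :: u) c) 1)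
    (t : Data) (d u : List Γ') :
    Runs (moveTo mark push) ((none, none), F (t.code ++ d) u [])
      ((none, none), F d (t.code.reverse ++ .comma :: u) []) (7 * t.size + 4) := by
  -- The claim allows an arbitrary continuation to `z`, so that the inductive hypotheses for two
  -- consecutive subtrees can be chained.
  have key : ∀ (t : Data) (d u c : List Γ') (x : Γ') (z : Reg × Mem) (n : ℕ),
      Runs (.loop (fun v => v.1.isSome)
      (popD ;; push ;;
        .ite (fun v => v.1 == some (.bit true))
          (.push .c (fun _ => .comma) ;; .push .c (fun _ => .comma) ;; popC) popC))
        ((c.head?, none), F d (t.code.reverse ++ u) c.tail) z n →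
      Runs (.loop (fun v => v.1.isSome)
      (popD ;; push ;;
        .ite (fun v => v.1 == some (.bit true))
          (.push .c (fun _ => .comma) ;; .push .c (fun _ => .comma) ;; popC) popC))
        ((some x, none), F (t.code ++ d) u c) z (7 * t.size + n) := by
    intro t
    induction t with
    | nil =>
      intro d u c x z n h
      refine (Runs.loop_step rfl ((hd _ _ _ _ _).seq ((hpush _ _ _ _ _).seq
        (Runs.ite_false (by simp) (hc _ _ _ _)))) h).mono ?_
      simp
    | cons t₁ t₂ h₁ h₂ =>
      intro d u c x z n h
      have := h₁ (t₂.code ++ d) (.bit true :: u) (.comma :: c) .comma z (7 * t₂.size + n)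
        (h₂ d _ c _ _ _ (by simpa [Data.code] using h))
      refine (Runs.loop_step rfl ((hd _ _ _ _ _).seq ((hpush _ _ _ _ _).seq
        (Runs.ite_true (by simp) ((hc' _ _ _ _).seq ((hc' _ _ _ _).seq (hc _ _ _ _))))))
        (by simpa using this)).mono ?_
      simp; omega
  refine ((hmark _ _ _ _).seq ((Runs.load _ _ _).seq ((key t d _ [] _ _ _
    (Runs.loop_exit rfl)).seq (Runs.load _ _ _)))).mono ?_
  omega

/-- Move the tree on top of the data stack to `a`. -/
def toA : Prog := moveTo (.push .a fun _ => .comma) pushA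
/-- Move the tree on top of the data stack to `b`. -/
def toB : Prog := moveTo (.push .b fun _ => .comma) pushB
/-- Move a tree from `a` to the data stack. -/
def fromA : Prog := transfer popA pushD
/-- Move a tree from `b` to the data stack. -/
def fromB : Prog := transfer popB pushD

variable (d a b c : List Γ') (o : List Bool)

theorem toA_runs (t : Data) : Runs toA ((none, none), mem (t.code ++ d) a b [] o)
    ((none, none), mem d (t.code.reverse ++ .comma :: a) b [] o) (7 * t.size + 4) :=
  moveTo_runs (fun d u c => mem d u b c o) (fun _ _ _ _ _ => Runs.pop_d _ _ _ _ _ _ _)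
    (fun _ _ _ _ => Runs.pop_c _ _ _ _ _ _ _) (fun _ _ _ _ => Runs.push_c _ _ _ _ _ _ _)
    (fun _ _ _ _ => Runs.push_a _ _ _ _ _ _ _)
    (fun _ _ _ _ _ => Runs.push_a _ _ _ _ _ _ _) t d a

theorem toB_runs (t : Data) : Runs toB ((none, none), mem (t.code ++ d) a b [] o)
    ((none, none), mem d a (t.code.reverse ++ .comma :: b) [] o) (7 * t.size + 4) :=
  moveTo_runs (fun d u c => mem d a u c o) (fun _ _ _ _ _ => Runs.pop_d _ _ _ _ _ _ _)
    (fun _ _ _ _ => Runs.pop_c _ _ _ _ _ _ _) (fun _ _ _ _ => Runs.push_c _ _ _ _ _ _ _)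
    (fun _ _ _ _ => Runs.push_b _ _ _ _ _ _ _) (fun _ _ _ _ _ => Runs.push_b _ _ _ _ _ _ _) t d b

theorem fromA_runs (t : Data) :
    Runs fromA ((none, none), mem d (t.code.reverse ++ .comma :: a) b c o)
      ((none, none), mem (t.code ++ d) a b c o) (3 * t.size + 3) := by
  have := transfer_runs (pop := popA) (push := pushD) (fun w u => mem u w b c o)
    (fun _ _ _ _ => Runs.pop_a _ _ _ _ _ _ _)
    (fun _ _ _ _ => Runs.push_d _ _ _ _ _ _ _) t.code.reverse
    (by simpa using t.comma_notMem_code) a d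
  simpa [Data.size, fromA] using this

theorem fromB_runs (t : Data) :
    Runs fromB ((none, none), mem d a (t.code.reverse ++ .comma :: b) c o)
      ((none, none), mem (t.code ++ d) a b c o) (3 * t.size + 3) := by
  have := transfer_runs (pop := popB) (push := pushD) (fun w u => mem u a w c o)
    (fun _ _ _ _ => Runs.pop_b _ _ _ _ _ _ _)
    (fun _ _ _ _ => Runs.push_d _ _ _ _ _ _ _) t.code.reverse
    (by simpa using t.comma_notMem_code) b d
  simpa [Data.size, fromB] using this

end Prog

end BusOut

/-! ### Operations on the trees of the data stack. -/

namespace BusOut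

open Computability Turing

/-- The code of a list of trees, the first one on top. -/
def codes : List Data → List Γ'
  | [] => []
  | t :: X => t.code ++ codes X

/-- The program `p` replaces the trees `X` on the data stack by the trees `Y`, and preserves the
other stacks. -/
def Op (p : Prog) (X Y : List Data) (N : ℕ) : Prop :=
  ∀ a b o, Runs p ((none, none), mem (codes X) a b [] o) ((none, none), mem (codes Y) a b [] o) N

/-- The tree that stands for a truth value. -/
def Data.ofBool : Bool → Data
  | false => .nil
  | true => .cons .nil .nil

/-- The first symbol of the code. -/
def Data.tag : Data → Γ'
  | nil => .bit false
  | cons _ _ => .bit true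

namespace Prog

/-- Apply a program below the tree on top of the stack. -/
def dip (p : Prog) : Prog := toA ;; p ;; fromA

/-- Remove the symbols up to the first comma. -/
def clearA : Prog := .loop (fun v => v.1 != some .comma) popA
/-- Remove the symbols up to the first comma, using the second register. -/
def clearB : Prog := .loop (fun v => v.2 != some .comma) (.pop .b fun v s => (v.1, s))

/-- Remove the tree on top. -/
def drop : Prog := toA ;; clearA ;; reset

/-- Duplicate the tree on top. -/
def dup : Prog :=
  toA ;; .push .b (fun _ => .comma) ;; transfer popA (pushD ;; pushB) ;;
    .push .a (fun _ => .comma) ;; transfer popB pushA ;; fromA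

/-- Swap the two trees on top. -/
def swap : Prog := toA ;; toB ;; fromA ;; fromB

/-- Push a word. -/
def pushWord : List Γ' → Prog
  | [] => reset
  | x :: w => pushWord w ;; .push .d fun _ => x

/-- Join the two trees on top. -/
def join : Prog := .push .d fun _ => .bit true

/-- Remove the first symbol of the code of the tree on top, and reset the registers. -/
def split : Prog := .pop .d fun _ _ => (none, none)

/-- Load the first symbol of the code of the tree on top. -/
def peek : Prog := popD ;; pushD

/-- Test the two trees on top for equality. -/
def test : Prog :=
  toA ;; toB ;;
    .loop (fun v => v.1 == v.2 && v.1 != some .comma) (popA ;; .pop .b fun v s => (v.1, s)) ;;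
    .ite (fun v => v.1 == v.2) (reset ;; pushWord (Data.ofBool true).code)
      (clearA ;; clearB ;; reset ;; pushWord (Data.ofBool false).code)

end Prog

namespace Op

open Prog

variable {p q : Prog} {X Y Z : List Data} {m n : ℕ} {s t : Data}

theorem mono (h : Op p X Y m) (hmn : m ≤ n) : Op p X Y n := fun a b o => (h a b o).mono hmn

theorem seq (hp : Op p X Y m) (hq : Op q Y Z n) : Op (p ;; q) X Z (m + n) :=
  fun a b o => (hp a b o).seq (hq a b o)

/-- The tree waits on `a` above a comma. The program `p` may run meanwhile, because `Op` allows
arbitrary contents of `a` and preserves them. -/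
theorem dip (h : Op p X Y n) : Op (dip p) (t :: X) (t :: Y) (n + 10 * t.size + 7) := by
  intro a b o
  refine ((toA_runs _ _ _ _ t).seq ((h _ b o).seq (fromA_runs _ _ _ _ _ t))).mono ?_
  omega

theorem popA_runs (v : Reg) (x : Γ') (d a b c : List Γ') (o : List Bool) :
    Runs popA (v, mem d (x :: a) b c o) ((some x, v.2), mem d a b c o) 1 :=
  Runs.pop_a _ _ _ _ _ _ _

theorem popB_runs (v : Reg) (x : Γ') (d a b c : List Γ') (o : List Bool) :
    Runs (.pop .b fun v s => (v.1, s)) (v, mem d a (x :: b) c o)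
      ((v.1, some x), mem d a b c o) 1 :=
  Runs.pop_b _ _ _ _ _ _ _

theorem clearA_runs (d w a b c : List Γ') (o : List Bool) (v : Reg) (hw : Γ'.comma ∉ w)
    (hv : v.1 ≠ some .comma) :
    Runs clearA (v, mem d (w ++ .comma :: a) b c o) ((some .comma, v.2), mem d a b c o)
      (2 * w.length + 3) := by
  induction w generalizing v with
  | nil =>
    exact (Runs.loop_step (by simpa using hv) (popA_runs _ _ _ _ _ _ _)
      (Runs.loop_exit (by simp))).mono (by simp)
  | cons x w ih =>
    simp only [List.mem_cons, not_or] at hw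
    refine (Runs.loop_step (by simpa using hv) (popA_runs _ _ _ _ _ _ _)
      (ih _ hw.2 ?_)).mono ?_
    · simpa using Ne.symm hw.1
    · simp only [List.length_cons]; omega

theorem clearB_runs (d w a b c : List Γ') (o : List Bool) (v : Reg) (hw : Γ'.comma ∉ w)
    (hv : v.2 ≠ some .comma) :
    Runs clearB (v, mem d a (w ++ .comma :: b) c o) ((v.1, some .comma), mem d a b c o)
      (2 * w.length + 3) := by
  induction w generalizing v with
  | nil =>
    exact (Runs.loop_step (by simpa using hv) (popB_runs _ _ _ _ _ _ _)
      (Runs.loop_exit (by simp))).mono (by simp)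
  | cons x w ih =>
    simp only [List.mem_cons, not_or] at hw
    refine (Runs.loop_step (by simpa using hv) (popB_runs _ _ _ _ _ _ _)
      (ih _ hw.2 ?_)).mono ?_
    · simpa using Ne.symm hw.1
    · simp only [List.length_cons]; omega

theorem drop : Op drop (t :: X) X (9 * t.size + 8) := by
  intro a b o
  refine ((toA_runs _ _ _ _ t).seq ((clearA_runs _ t.code.reverse _ _ _ _ _
    (by simpa using t.comma_notMem_code) (by simp)).seq (Runs.load _ _ _))).mono ?_
  simp [Data.size]; omega

/-- Moving to `a` reverses the code. The transfer back writes it to `d` and `b` at once; the copy on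
`b` is reversed onto `a` and delivered from there as the second tree. -/
theorem dup : Op dup (t :: X) (t :: t :: X) (17 * t.size + 15) := by
  intro a b o
  have h₁ := transfer_runs (pop := popA) (push := pushD ;; pushB)
    (fun w u => mem (u ++ codes X) w (u ++ .comma :: b) [] o)
    (fun _ _ _ _ => Runs.pop_a _ _ _ _ _ _ _)
    (fun _ _ _ _ => (Runs.push_d _ _ _ _ _ _ _).seq (Runs.push_b _ _ _ _ _ _ _))
    t.code.reverse (by simpa using t.comma_notMem_code) a []
  have h₂ := transfer_runs (pop := popB) (push := pushA)
    (fun w u => mem (codes (t :: X)) u w [] o)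
    (fun _ _ _ _ => Runs.pop_b _ _ _ _ _ _ _)
    (fun _ _ _ _ => Runs.push_a _ _ _ _ _ _ _)
    t.code t.comma_notMem_code b (.comma :: a)
  simp only [List.reverse_reverse, List.append_nil, List.length_reverse, List.nil_append] at h₁
  refine ((toA_runs _ _ _ _ t).seq ((Runs.push_b _ _ _ _ _ _ _).seq (h₁.seq
    ((Runs.push_a _ _ _ _ _ _ _).seq (h₂.seq (fromA_runs _ _ _ _ _ t)))))).mono ?_
  simp only [Data.size]; omega

theorem swap : Op swap (s :: t :: X) (t :: s :: X) (10 * s.size + 10 * t.size + 14) := by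
  intro a b o
  refine ((toA_runs _ _ _ _ s).seq ((toB_runs _ _ _ _ t).seq ((fromA_runs _ _ _ _ _ s).seq
    (fromB_runs _ _ _ _ _ t)))).mono ?_
  omega

theorem pushWord_runs (v : Reg) (d a b c : List Γ') (o : List Bool) (w : List Γ') :
    Runs (pushWord w) (v, mem d a b c o) ((none, none), mem (w ++ d) a b c o)
      (w.length + 1) := by
  induction w with
  | nil => exact Runs.load _ _ _
  | cons x w ih => exact (ih.seq (Runs.push_d _ _ _ _ _ _ _)).mono (by simp)

theorem const (t : Data) : Op (pushWord t.code) X (t :: X) (t.size + 1) :=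
  fun _ _ _ => pushWord_runs _ _ _ _ _ _ _

theorem join : Op join (s :: t :: X) (.cons s t :: X) 1 := by
  intro a b o
  have := Runs.push_d (none, none) (codes (s :: t :: X)) a b [] o (fun _ => .bit true)
  simpa [codes, Data.code, Prog.join] using this

theorem split_runs (v : Reg) (a b : List Γ') (o : List Bool) :
    Runs Prog.split (v, mem (codes (.cons s t :: X)) a b [] o)
      ((none, none), mem (codes (s :: t :: X)) a b [] o) 1 := by
  rw [show codes (.cons s t :: X) = .bit true :: codes (s :: t :: X) by simp [codes, Data.code]]
  exact Runs.pop_d _ _ _ _ _ _ _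

theorem split_nil_runs (v : Reg) (a b : List Γ') (o : List Bool) :
    Runs Prog.split (v, mem (codes (.nil :: X)) a b [] o)
      ((none, none), mem (codes X) a b [] o) 1 :=
  Runs.pop_d _ _ _ _ _ _ _

theorem split : Op split (.cons s t :: X) (s :: t :: X) 1 :=
  fun _ _ _ => split_runs _ _ _ _

theorem peek_runs (a b : List Γ') (o : List Bool) :
    Runs peek ((none, none), mem (codes (t :: X)) a b [] o)
      ((some t.tag, none), mem (codes (t :: X)) a b [] o) 2 := by
  cases t <;> exact (Runs.pop_d _ _ _ _ _ _ _).seq (Runs.push_d _ _ _ _ _ _ _)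

/-- The state of a stack after the symbol in a register was removed from `u` and a comma. -/
def Rest (u a : List Γ') (s : Option Γ') (x : List Γ') : Prop :=
  (s = some .comma ∧ x = a) ∨
    (s ≠ some .comma ∧ ∃ w, Γ'.comma ∉ w ∧ w.length ≤ u.length ∧ x = w ++ .comma :: a)

theorem Rest.of_cons {y : Γ'} {u a z : List Γ'} {s : Option Γ'} (h : Rest u a s z) :
    Rest (y :: u) a s z := by
  rcases h with h | ⟨h, w, h₁, h₂, h₃⟩
  · exact Or.inl h
  · exact Or.inr ⟨h, w, h₁, by simp; omega, h₃⟩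

/-- The loop stops at the first disagreement or when both commas have been read, so equal registers
at the exit mean equal words. Otherwise `Rest` records for each stack whether its comma is already
gone, which is what the clearing loops need to know. -/
theorem compare_runs (d a b c : List Γ') (o : List Bool) (u w : List Γ') (z : Option Γ')
    (hu : Γ'.comma ∉ u) (hw : Γ'.comma ∉ w) (hz : z ≠ some .comma) :
    ∃ s s' a' b',
      Runs (.loop (fun v => v.1 == v.2 && v.1 != some .comma)
        (popA ;; .pop .b fun v s => (v.1, s)))
        ((z, z), mem d (u ++ .comma :: a) (w ++ .comma :: b) c o)
        ((s, s'), mem d a' b' c o) (3 * u.length + 4) ∧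
      ((u = w ∧ s = s' ∧ a' = a ∧ b' = b) ∨
        (u ≠ w ∧ s ≠ s' ∧ Rest u a s a' ∧ Rest w b s' b')) := by
  induction u generalizing w z with
  | nil =>
    cases w with
    | nil =>
      refine ⟨some .comma, some .comma, a, b, ?_, Or.inl ⟨rfl, rfl, rfl, rfl⟩⟩
      exact (Runs.loop_step (by simpa using hz) ((popA_runs _ _ _ _ _ _ _).seq
        (popB_runs _ _ _ _ _ _ _)) (Runs.loop_exit (by simp))).mono (by simp)
    | cons y w =>
      simp only [List.mem_cons, not_or] at hw
      refine ⟨some .comma, some y, a, w ++ .comma :: b, ?_, Or.inr ⟨by simp, by simpa using hw.1,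
        Or.inl ⟨rfl, rfl⟩, Or.inr ⟨by simpa using Ne.symm hw.1, w, hw.2, by simp, rfl⟩⟩⟩
      exact (Runs.loop_step (by simpa using hz) ((popA_runs _ _ _ _ _ _ _).seq
        (popB_runs _ _ _ _ _ _ _)) (Runs.loop_exit (by simp))).mono (by simp)
  | cons x u ih =>
    simp only [List.mem_cons, not_or] at hu
    cases w with
    | nil =>
      refine ⟨some x, some .comma, u ++ .comma :: a, b, ?_, Or.inr ⟨by simp,
        by simpa using Ne.symm hu.1,
        Or.inr ⟨by simpa using Ne.symm hu.1, u, hu.2, by simp, rfl⟩, Or.inl ⟨rfl, rfl⟩⟩⟩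
      refine (Runs.loop_step (by simpa using hz) ((popA_runs _ _ _ _ _ _ _).seq
        (popB_runs _ _ _ _ _ _ _)) (Runs.loop_exit ?_)).mono (by simp)
      simp [Ne.symm hu.1]
    | cons y w =>
      simp only [List.mem_cons, not_or] at hw
      by_cases hxy : x = y
      · subst hxy
        obtain ⟨s, s', a', b', hr, h⟩ := ih w (some x) hu.2 hw.2 (by simpa using Ne.symm hu.1)
        refine ⟨s, s', a', b', (Runs.loop_step (by simpa using hz)
          ((popA_runs _ _ _ _ _ _ _).seq (popB_runs _ _ _ _ _ _ _)) hr).mono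
          (by simp; omega), ?_⟩
        rcases h with ⟨rfl, h⟩ | ⟨h₁, h₂, h₃, h₄⟩
        · exact Or.inl ⟨rfl, h⟩
        · exact Or.inr ⟨by simpa using h₁, h₂, h₃.of_cons, h₄.of_cons⟩
      · refine ⟨some x, some y, u ++ .comma :: a, w ++ .comma :: b, ?_, Or.inr ⟨by simp [hxy],
          by simpa using hxy, Or.inr ⟨by simpa using Ne.symm hu.1, u, hu.2, by simp, rfl⟩,
          Or.inr ⟨by simpa using Ne.symm hw.1, w, hw.2, by simp, rfl⟩⟩⟩
        refine (Runs.loop_step (by simpa using hz) ((popA_runs _ _ _ _ _ _ _).seq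
          (popB_runs _ _ _ _ _ _ _)) (Runs.loop_exit ?_)).mono (by simp)
        simp [hxy]

theorem test : Op test (s :: t :: X) (Data.ofBool (decide (s = t)) :: X)
    (12 * s.size + 9 * t.size + 29) := by
  intro a b o
  obtain ⟨x, x', a', b', hr, h⟩ := compare_runs (codes X) a b [] o s.code.reverse t.code.reverse
    none (by simpa using s.comma_notMem_code) (by simpa using t.comma_notMem_code) (by simp)
  rw [List.length_reverse] at hr
  rcases h with ⟨e, rfl, rfl, rfl⟩ | ⟨e, hx, h₁, h₂⟩
  · obtain rfl := Data.code_injective (List.reverse_injective e)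
    rw [decide_eq_true rfl]
    refine ((toA_runs _ _ _ _ s).seq ((toB_runs _ _ _ _ s).seq (hr.seq (Runs.ite_true (by simp)
      ((Runs.load _ _ _).seq (pushWord_runs _ _ _ _ _ _ _)))))).mono ?_
    simp only [Data.ofBool, Data.code, Data.size, List.length_cons, List.length_append,
      List.length_nil]
    omega
  · rw [decide_eq_false (fun h => e (by rw [h]))]
    have h₁' : Runs clearA ((x, x'), mem (codes X) a' b' [] o)
        ((some .comma, x'), mem (codes X) a b' [] o) (2 * s.size + 3) := by
      rcases h₁ with ⟨rfl, rfl⟩ | ⟨hx, w, hw, hl, rfl⟩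
      · exact (Runs.loop_exit (by simp)).mono (by omega)
      · exact (clearA_runs _ _ _ _ _ _ _ hw hx).mono (by simp [Data.size] at hl ⊢; omega)
    have h₂' : Runs clearB ((some .comma, x'), mem (codes X) a b' [] o)
        ((some .comma, some .comma), mem (codes X) a b [] o) (2 * t.size + 3) := by
      rcases h₂ with ⟨rfl, rfl⟩ | ⟨hx, w, hw, hl, rfl⟩
      · exact (Runs.loop_exit (by simp)).mono (by omega)
      · exact (clearB_runs _ _ _ _ _ _ _ hw hx).mono (by simp [Data.size] at hl ⊢; omega)
    refine ((toA_runs _ _ _ _ s).seq ((toB_runs _ _ _ _ t).seq (hr.seq (Runs.ite_false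
      (by simpa using hx) (h₁'.seq (h₂'.seq ((Runs.load _ _ _).seq
        (pushWord_runs _ _ _ _ _ _ _)))))))).mono ?_
    simp only [Data.ofBool, Data.code, Data.size, List.length_cons, List.length_nil]
    omega

end Op

end BusOut

namespace BusOut

open Computability Turing

/-! ### Polynomially bounded functions -/

/-- The function is bounded by a polynomial. -/
def PolyBdd (g : ℕ → ℕ) : Prop := ∃ k, ∀ n, g n ≤ (n + 2) ^ k

namespace PolyBdd

variable {f g : ℕ → ℕ}

theorem mono (hg : PolyBdd g) (h : ∀ n, f n ≤ g n) : PolyBdd f :=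
  let ⟨k, hk⟩ := hg
  ⟨k, fun n => (h n).trans (hk n)⟩

theorem pow_self (k : ℕ) : PolyBdd fun n => (n + 2) ^ k := ⟨k, fun _ => le_rfl⟩

/-- This is why the base is `n + 2`: since it is at least two, its power `c` exceeds the constant
`c`, and sums of bounds cost only one more factor. -/
theorem const (c : ℕ) : PolyBdd fun _ => c :=
  ⟨c, fun n => (Nat.lt_two_pow_self).le.trans (Nat.pow_le_pow_left (by omega) c)⟩

theorem id : PolyBdd fun n => n := ⟨1, fun n => by simp⟩

theorem add (hf : PolyBdd f) (hg : PolyBdd g) : PolyBdd fun n => f n + g n := by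
  obtain ⟨k, hk⟩ := hf
  obtain ⟨l, hl⟩ := hg
  refine ⟨k + l + 1, fun n => ?_⟩
  have h₁ : (n + 2) ^ k ≤ (n + 2) ^ (k + l) := Nat.pow_le_pow_right (by omega) (by omega)
  have h₂ : (n + 2) ^ l ≤ (n + 2) ^ (k + l) := Nat.pow_le_pow_right (by omega) (by omega)
  have h₃ := hk n
  have h₄ := hl n
  rw [pow_succ]
  have : (n + 2) ^ (k + l) * 2 ≤ (n + 2) ^ (k + l) * (n + 2) := Nat.mul_le_mul_left _ (by omega)
  change f n + g n ≤ _
  omega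

theorem mul (hf : PolyBdd f) (hg : PolyBdd g) : PolyBdd fun n => f n * g n := by
  obtain ⟨k, hk⟩ := hf
  obtain ⟨l, hl⟩ := hg
  exact ⟨k + l, fun n => by rw [pow_add]; exact Nat.mul_le_mul (hk n) (hl n)⟩

theorem pow (hf : PolyBdd f) (l : ℕ) : PolyBdd fun n => f n ^ l := by
  obtain ⟨k, hk⟩ := hf
  exact ⟨k * l, fun n => by rw [pow_mul]; exact Nat.pow_le_pow_left (hk n) l⟩

theorem comp_pow (hf : PolyBdd f) (k : ℕ) : PolyBdd fun n => (f n + 2) ^ k :=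
  (hf.add (const 2)).pow k

theorem comp (hg : PolyBdd g) (hf : PolyBdd f) : PolyBdd fun n => g (f n) := by
  obtain ⟨k, hk⟩ := hg
  exact (hf.comp_pow k).mono fun n => hk _

end PolyBdd

/-! ### Functions computable in polynomial time -/

/-- Types whose elements are coded by trees. -/
class Enc (α : Type) where
  enc : α → Data
  inj : Function.Injective enc

open Enc

instance : Enc Data := ⟨id, fun _ _ h => h⟩

instance : Enc Unit := ⟨fun _ => .nil, fun _ _ _ => rfl⟩

instance : Enc Bool := ⟨Data.ofBool, fun x y h => by cases x <;> cases y <;> simp_all [Data.ofBool]⟩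

instance {α β : Type} [Enc α] [Enc β] : Enc (α × β) :=
  ⟨fun p => .cons (enc p.1) (enc p.2), fun p q h => by
    simp only [Data.cons.injEq] at h
    exact Prod.ext (inj h.1) (inj h.2)⟩

instance {α : Type} [Enc α] (p : α → Prop) : Enc (Subtype p) :=
  ⟨fun x => enc x.1, fun _ _ h => Subtype.ext (inj h)⟩

/-- The tree that stands for an optional element. -/
def encOption {α : Type} [Enc α] : Option α → Data
  | none => .nil
  | some x => .cons .nil (enc x)

instance {α : Type} [Enc α] : Enc (Option α) :=
  ⟨encOption, fun x y h => by
    cases x <;> cases y <;> simp_all [encOption]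
    exact inj h⟩

/-- The tree that stands for a list. -/
def encTreeList {α : Type} [Enc α] : List α → Data
  | [] => .nil
  | x :: l => .cons (enc x) (encTreeList l)

instance {α : Type} [Enc α] : Enc (List α) :=
  ⟨encTreeList, fun x => by
    induction x with
    | nil => intro y h; cases y <;> simp_all [encTreeList]
    | cons a x ih =>
      intro y h
      cases y with
      | nil => simp [encTreeList] at h
      | cons b y =>
        simp only [encTreeList, Data.cons.injEq] at h
        rw [inj h.1, ih h.2]⟩

/-- The tree that stands for a number, in unary. -/
def encUnary : ℕ → Data
  | 0 => .nil
  | n + 1 => .cons .nil (encUnary n)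

instance : Enc ℕ :=
  ⟨encUnary, fun m => by
    induction m with
    | zero => intro n h; cases n <;> simp_all [encUnary]
    | succ m ih =>
      intro n h
      cases n with
      | zero => simp [encUnary] at h
      | succ n =>
        simp only [encUnary, Data.cons.injEq, true_and] at h
        rw [ih h]⟩

section
variable {α β : Type} [Enc α] [Enc β]

@[simp] theorem enc_data (t : Data) : enc t = t := rfl
@[simp] theorem enc_pair (x : α) (y : β) : enc (x, y) = .cons (enc x) (enc y) := rfl
@[simp] theorem enc_sub (p : α → Prop) (x : Subtype p) : enc x = enc x.1 := rfl
@[simp] theorem enc_none : enc (none : Option α) = .nil := rfl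
@[simp] theorem enc_some (x : α) : enc (some x) = .cons .nil (enc x) := rfl
@[simp] theorem enc_nil : enc ([] : List α) = .nil := rfl
@[simp] theorem enc_cons (x : α) (l : List α) : enc (x :: l) = .cons (enc x) (enc l) := rfl
@[simp] theorem enc_zero : enc 0 = .nil := rfl
@[simp] theorem enc_succ (n : ℕ) : enc (n + 1) = .cons .nil (enc n) := rfl
@[simp] theorem enc_true : enc true = .cons .nil .nil := rfl
@[simp] theorem enc_false : enc false = .nil := rfl
@[simp] theorem enc_unit (u : Unit) : enc u = .nil := rfl

/-- The size of an element. -/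
def sz (x : α) : ℕ := (enc x).size

theorem sz_pos (x : α) : 0 < sz x := Data.size_pos _
@[simp] theorem sz_pair (x : α) (y : β) : sz (x, y) = sz x + sz y + 1 := by simp [sz]
@[simp] theorem sz_sub (p : α → Prop) (x : Subtype p) : sz x = sz x.1 := rfl
@[simp] theorem sz_nil : sz ([] : List α) = 1 := rfl
@[simp] theorem sz_cons (x : α) (l : List α) : sz (x :: l) = sz x + sz l + 1 := by simp [sz]
@[simp] theorem sz_succ (n : ℕ) : sz (n + 1) = sz n + 2 := by simp [sz]; omega

theorem sz_bool (b : Bool) : sz b ≤ 3 := by cases b <;> simp [sz]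

theorem sz_nat (n : ℕ) : sz n = 2 * n + 1 := by
  induction n with
  | zero => rfl
  | succ n ih => rw [sz_succ, ih]; ring

theorem sz_append (l l' : List α) : sz (l ++ l') + 1 = sz l + sz l' := by
  induction l with
  | nil => simp; omega
  | cons x l ih => simp; omega

theorem length_le_sz (l : List α) : l.length < sz l := by
  induction l with
  | nil => simp
  | cons x l ih => simp; omega

theorem sz_le_of_mem {x : α} {l : List α} (h : x ∈ l) : sz x < sz l := by
  induction l with
  | nil => simp at h
  | cons y l ih =>
    rcases List.mem_cons.1 h with rfl | h
    · simp
    · have := ih h; simp; omega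

theorem sz_le_of_forall {l : List α} {N : ℕ} (h : ∀ x ∈ l, sz x ≤ N) :
    sz l ≤ l.length * (N + 1) + 1 := by
  induction l with
  | nil => simp
  | cons y l ih =>
    have h₁ := h y (by simp)
    have h₂ := ih fun x hx => h x (by simp [hx])
    simp only [sz_cons, List.length_cons, add_mul, one_mul]
    omega

end

/-- The function is computed by a program in polynomial time. -/
def PolyTime {α β : Type} [Enc α] [Enc β] (f : α → β) : Prop :=
  ∃ p k, ∀ x R, Op p (enc x :: R) (enc (f x) :: R) ((sz x + 2) ^ k)

/-- A step pushes at most one symbol. Hence a time bound also bounds the size of the result, which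
is needed to bound the time of a composition. -/
theorem Exec.length_d_le {p : Prog} {x y : Reg × Mem} {n : ℕ} (h : Exec p x n y) :
    (y.2 .d).length ≤ (x.2 .d).length + n := by
  induction h with
  | push k f v S =>
    by_cases hk : k = .d
    · subst hk; simp
    · simp [Function.update_of_ne (Ne.symm hk)]
  | pop k f v S =>
    by_cases hk : k = .d
    · subst hk; simp; omega
    · simp [Function.update_of_ne (Ne.symm hk)]
  | load => simp
  | seq => omega
  | ite_true => omega
  | ite_false => omega
  | loop_exit => omega
  | loop_step => omega

theorem Op.size_le {p : Prog} {s t : Data} {N : ℕ} (h : Op p [s] [t] N) : t.size ≤ s.size + N := by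
  obtain ⟨n, hn, h⟩ := h [] [] []
  have := h.length_d_le
  simp only [mem_d, codes, List.append_nil] at this
  exact this.trans (Nat.add_le_add_left hn _)

namespace PolyTime

open Prog

variable {α β γ δ : Type} [Enc α] [Enc β] [Enc γ] [Enc δ]

theorem of_bdd {f : α → β} (p : Prog) {g : ℕ → ℕ} (hg : PolyBdd g)
    (h : ∀ x R, Op p (enc x :: R) (enc (f x) :: R) (g (sz x))) : PolyTime f :=
  let ⟨k, hk⟩ := hg
  ⟨p, k, fun x R => (h x R).mono (hk _)⟩

theorem sz_le {f : α → β} {p : Prog} {k : ℕ}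
    (h : ∀ x R, Op p (enc x :: R) (enc (f x) :: R) ((sz x + 2) ^ k)) (x : α) :
    sz (f x) ≤ sz x + (sz x + 2) ^ k :=
  (h x []).size_le

/-- Programs see only codes, so a change of type that keeps the tree needs no program. This serves
for subtypes, for constructors that are pairs in disguise, and for numbers as lists of units. -/
theorem of_enc {f : α → β} {g : γ → δ} (hg : PolyTime g) (φ : α → γ)
    (hφ : ∀ x, enc (φ x) = enc x) (h : ∀ x, enc (f x) = enc (g (φ x))) : PolyTime f := by
  obtain ⟨p, k, hp⟩ := hg
  refine ⟨p, k, fun x R => ?_⟩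
  have := hp (φ x) R
  rwa [sz, hφ, ← h] at this

theorem id : PolyTime fun x : α => x :=
  of_bdd reset (.const 1) fun _ _ _ _ _ => Runs.load _ _ _

theorem const (y : β) : PolyTime fun _ : α => y := by
  refine of_bdd (drop ;; pushWord (enc y).code)
    (g := fun n => (9 * n + 8) + ((enc y).size + 1)) ?_ fun x R => Op.drop.seq (Op.const _)
  exact (((PolyBdd.const 9).mul .id).add (.const 8)).add (.const _)

theorem comp {g : β → γ} {f : α → β} (hg : PolyTime g) (hf : PolyTime f) :
    PolyTime fun x => g (f x) := by
  obtain ⟨q, l, hq⟩ := hg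
  obtain ⟨p, k, hp⟩ := hf
  refine of_bdd (p ;; q) (g := fun n => (n + 2) ^ k + ((n + (n + 2) ^ k) + 2) ^ l) ?_
    fun x R => ((hp x R).seq (hq (f x) R)).mono ?_
  · exact (PolyBdd.pow_self k).add ((PolyBdd.id.add (.pow_self k)).comp_pow l)
  · have := sz_le hp x
    gcongr

theorem pair {f : α → β} {g : α → γ} (hf : PolyTime f) (hg : PolyTime g) :
    PolyTime fun x => (f x, g x) := by
  obtain ⟨p, k, hp⟩ := hf
  obtain ⟨q, l, hq⟩ := hg
  refine of_bdd (dup ;; p ;; dip q ;; join)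
    (g := fun n => 17 * n + 15 + ((n + 2) ^ k + ((n + 2) ^ l + 10 * (n + (n + 2) ^ k) + 7 + 1))) ?_
    fun x R => (Op.dup.seq ((hp x _).seq ((hq x R).dip.seq Op.join))).mono ?_
  · exact (((PolyBdd.const 17).mul .id).add (.const 15)).add ((PolyBdd.pow_self k).add
      ((((PolyBdd.pow_self l).add ((PolyBdd.const 10).mul (PolyBdd.id.add (.pow_self k)))).add
        (.const 7)).add (.const 1)))
  · have : (enc (f x)).size ≤ sz x + (sz x + 2) ^ k := sz_le hp x
    have h' : (enc x).size = sz x := rfl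
    omega

theorem fst : PolyTime (Prod.fst : α × β → α) := by
  refine of_bdd (split ;; dip drop) (g := fun n => 19 * n + 16) ?_
    fun x R => (Op.split.seq Op.drop.dip).mono ?_
  · exact ((PolyBdd.const 19).mul .id).add (.const 16)
  · obtain ⟨x, y⟩ := x
    simp [sz]; omega

theorem snd : PolyTime (Prod.snd : α × β → β) := by
  refine of_bdd (split ;; drop) (g := fun n => 19 * n + 16) ?_
    fun x R => (Op.split.seq Op.drop).mono ?_
  · exact ((PolyBdd.const 19).mul .id).add (.const 16)
  · obtain ⟨x, y⟩ := x
    simp [sz]; omega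

theorem decide_eq {f g : α → β} [∀ x, Decidable (f x = g x)] (hf : PolyTime f) (hg : PolyTime g) :
    PolyTime fun x => decide (f x = g x) := by
  have key : PolyTime fun p : Data × Data => decide (p.1 = p.2) := by
    refine of_bdd (split ;; test) (g := fun n => 21 * n + 30) ?_
      fun x R => (Op.split.seq Op.test).mono ?_
    · exact ((PolyBdd.const 21).mul .id).add (.const 30)
    · obtain ⟨x, y⟩ := x
      simp [sz]; omega
  have hf' : PolyTime fun x => enc (f x) := hf.of_enc (fun x => x) (fun _ => rfl) fun _ => rfl
  have hg' : PolyTime fun x => enc (g x) := hg.of_enc (fun x => x) (fun _ => rfl) fun _ => rfl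
  refine (key.comp (hf'.pair hg')).of_enc (fun x => x) (fun _ => rfl) fun x => ?_
  have : (f x = g x) ↔ (enc (f x) = enc (g x)) := ⟨fun h => by rw [h], fun h => Enc.inj h⟩
  simp [this]

/-- Each branch need only be polynomial where its condition holds; the components of a tree can
therefore be used in the second branch without default values. -/
theorem ite_nil {c : α → Data} (hc : PolyTime c) {f : α → β}
    (h₁ : PolyTime fun x : {x // c x = .nil} => f x)
    (h₂ : PolyTime fun x : {x // c x ≠ .nil} => f x) : PolyTime f := by
  obtain ⟨r, m, hr⟩ := hc
  obtain ⟨p, k, hp⟩ := h₁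
  obtain ⟨q, l, hq⟩ := h₂
  refine of_bdd (dup ;; r ;; peek ;; .ite (fun v => v.1 == some (.bit true))
      (reset ;; drop ;; q) (reset ;; drop ;; p))
    (g := fun n => 17 * n + 15 + ((n + 2) ^ m + (9 * (n + (n + 2) ^ m) + 12 +
      ((n + 2) ^ k + (n + 2) ^ l)))) ?_ fun x R a b o => ?_
  · exact (((PolyBdd.const 17).mul .id).add (.const 15)).add ((PolyBdd.pow_self m).add
      ((((PolyBdd.const 9).mul (PolyBdd.id.add (.pow_self m))).add (.const 12)).add
        ((PolyBdd.pow_self k).add (.pow_self l))))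
  · have hs : (c x).size ≤ sz x + (sz x + 2) ^ m := sz_le hr x
    have h' : (enc x).size = sz x := rfl
    by_cases hx : c x = .nil
    · refine ((Op.dup a b o).seq ((hr x _ a b o).seq ((Op.peek_runs a b o).seq
        (Runs.ite_false ?_ ((Runs.load _ _ _).seq ((Op.drop a b o).seq
          (hp ⟨x, hx⟩ R a b o))))))).mono ?_
      · simp [hx, Data.tag]
      · simp at hs ⊢; omega
    · refine ((Op.dup a b o).seq ((hr x _ a b o).seq ((Op.peek_runs a b o).seq
        (Runs.ite_true ?_ ((Runs.load _ _ _).seq ((Op.drop a b o).seq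
          (hq ⟨x, hx⟩ R a b o))))))).mono ?_
      · cases h : c x <;> simp_all [Data.tag]
      · simp at hs ⊢; omega

/-- The body of the loop for `foldl`. -/
def foldBody (p : Prog) : Prog :=
  dip swap ;; swap ;; join ;; dip swap ;; dip dup ;; swap ;; join ;; p ;; dip swap ;; swap

/-- From the top, the stack holds the current element, the remaining list, the accumulator and the
parameter. The shuffling assembles the argument of `p` and keeps one copy of the parameter for the
next round. -/
theorem foldBody_op {p : Prog} {x h t y z : Data} {R : List Data} {N M : ℕ}
    (hp : Op p (.cons x (.cons y h) :: x :: t :: R) (z :: x :: t :: R) N)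
    (hx : x.size ≤ M) (hh : h.size ≤ M) (ht : t.size ≤ M) (hy : y.size ≤ M) (hz : z.size ≤ M) :
    Op (foldBody p) (h :: t :: y :: x :: R) (t :: z :: x :: R) (N + 240 * M + 240) := by
  refine (Op.swap.dip.seq (Op.swap.seq (Op.join.seq (Op.swap.dip.seq (Op.dup.dip.seq
    (Op.swap.seq (Op.join.seq (hp.seq (Op.swap.dip.seq Op.swap))))))))).mono ?_
  simp only [Data.size_cons]
  omega

/-- The bound `B` on all intermediate accumulators is essential, since a polynomial step such as
doubling can blow up when iterated. The step need only be polynomial on elements of the list, so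
facts about the actual entries can enter the time bound. -/
theorem foldl_mem {l : α → List β} {i : α → γ} {h : α → γ → β → γ} (hl : PolyTime l)
    (hi : PolyTime i)
    (hh : PolyTime fun p : {p : α × γ × β // p.2.2 ∈ l p.1} => h p.1.1 p.1.2.1 p.1.2.2)
    {B : ℕ → ℕ} (hB : PolyBdd B)
    (hb : ∀ x l₁ l₂, l x = l₁ ++ l₂ → sz (l₁.foldl (h x) (i x)) ≤ B (sz x)) :
    PolyTime fun x => (l x).foldl (h x) (i x) := by
  obtain ⟨p, k, hp⟩ := hl
  obtain ⟨q, m, hq⟩ := hi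
  obtain ⟨r, j, hr⟩ := hh
  let M : ℕ → ℕ := fun n => n + (n + 2) ^ k + B n
  have hM : PolyBdd M := (PolyBdd.id.add (.pow_self k)).add hB
  -- The cost of one round: the argument of `r` consists of three trees of size at most `M` and two
  -- pairing nodes; `foldBody_op` gives the terms with 240; splitting, peeking and testing cost 4.
  let W : ℕ → ℕ := fun n => (3 * M n + 2 + 2) ^ j + 240 * M n + 240 + 4
  have hW : PolyBdd W := (((((((PolyBdd.const 3).mul hM).add (.const 2)).comp_pow j).add
    ((PolyBdd.const 240).mul hM)).add (.const 240)).add (.const 4))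
  refine of_bdd (dup ;; p ;; dip (dup ;; q) ;; peek ;;
      .loop (fun v => v.1 == some (.bit true)) (split ;; foldBody r ;; peek) ;; split ;; dip drop)
    (g := fun n => 17 * n + 15 + ((n + 2) ^ k + (17 * n + 15 + (n + 2) ^ m + 10 * M n + 7 +
      (2 + (M n * W n + 1 + (1 + (9 * n + 8 + 10 * M n + 7))))))) ?_ fun x R a b o => ?_
  · exact (((PolyBdd.const 17).mul .id).add (.const 15)).add ((PolyBdd.pow_self k).add
      ((((((PolyBdd.const 17).mul .id).add (.const 15)).add (.pow_self m)).add
        ((PolyBdd.const 10).mul hM)).add (.const 7) |>.add ((PolyBdd.const 2).add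
          (((hM.mul hW).add (.const 1)).add ((PolyBdd.const 1).add
            (((((PolyBdd.const 9).mul .id).add (.const 8)).add
              ((PolyBdd.const 10).mul hM)).add (.const 7)))))))
  · have hx : (enc x).size = sz x := rfl
    have hlx : sz (l x) ≤ sz x + (sz x + 2) ^ k := sz_le hp x
    have hfin : (enc ((l x).foldl (h x) (i x))).size ≤ B (sz x) := hb x _ [] (by simp)
    have key : ∀ l₂ l₁, l x = l₁ ++ l₂ →
        Runs (.loop (fun v => v.1 == some (.bit true)) (split ;; foldBody r ;; peek))
          ((some (enc l₂).tag, none),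
            mem (codes (enc l₂ :: enc (l₁.foldl (h x) (i x)) :: enc x :: R)) a b [] o)
          ((some (.bit false), none),
            mem (codes (.nil :: enc ((l x).foldl (h x) (i x)) :: enc x :: R)) a b [] o)
          (l₂.length * W (sz x) + 1) := by
      intro l₂
      induction l₂ with
      | nil =>
        intro l₁ h₁
        rw [List.append_nil] at h₁
        rw [h₁]
        exact (Runs.loop_exit rfl).mono (by simp)
      | cons y l₂ ih =>
        intro l₁ h₁
        have h₂ : l x = (l₁ ++ [y]) ++ l₂ := by rw [h₁]; simp
        have hy : y ∈ l x := by rw [h₁]; simp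
        have hsz : sz y + sz l₂ < sz (l x) := by
          have := sz_append l₁ (y :: l₂)
          have h₃ := sz_pos l₁
          rw [h₁]
          simp at this
          omega
        have hy' : (enc y).size = sz y := rfl
        have hl' : (enc l₂).size = sz l₂ := rfl
        have hs₁ : (enc (l₁.foldl (h x) (i x))).size ≤ B (sz x) := hb x _ _ h₁
        have hs₂ : (enc (h x (l₁.foldl (h x) (i x)) y)).size ≤ B (sz x) := by
          have := hb x _ _ h₂
          rwa [List.foldl_append] at this
        have hbody := foldBody_op (M := M (sz x))
          (hr ⟨(x, l₁.foldl (h x) (i x), y), hy⟩ (enc x :: enc l₂ :: R))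
          (by simp only [M]; omega) (by simp only [M]; omega) (by simp only [M]; omega)
          (by simp only [M]; omega) (by simp only [M]; omega)
        have ih' := ih _ h₂
        rw [List.foldl_append] at ih'
        refine (Runs.loop_step rfl ((Op.split_runs _ _ _ _).seq ((hbody a b o).seq
          (Op.peek_runs _ _ _))) ih').mono ?_
        have hle : (sz (⟨(x, l₁.foldl (h x) (i x), y), hy⟩ :
            {p : α × γ × β // p.2.2 ∈ l p.1}) + 2) ^ j ≤ (3 * M (sz x) + 2 + 2) ^ j := by
          refine Nat.pow_le_pow_left ?_ j
          have : sz (l₁.foldl (h x) (i x)) ≤ B (sz x) := hs₁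
          simp only [sz_sub, sz_pair, M]
          omega
        simp only [List.length_cons, W, add_mul, one_mul]
        omega
    refine ((Op.dup a b o).seq ((hp x _ a b o).seq (((Op.dup.seq (hq x _)).dip a b o).seq
      ((Op.peek_runs a b o).seq ((key (l x) [] rfl).seq ((Op.split_nil_runs _ _ _ _).seq
        (Op.drop.dip a b o))))))).mono ?_
    have h₁ : (l x).length * W (sz x) ≤ M (sz x) * W (sz x) := by
      refine Nat.mul_le_mul_right _ ?_
      have := length_le_sz (l x)
      simp only [M]; omega
    have hlx' : (enc (l x)).size ≤ sz x + (sz x + 2) ^ k := hlx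
    simp only [M] at h₁ ⊢
    omega

end PolyTime

end BusOut

namespace BusOut

open Enc

/-! ### Derived functions -/

/-- Remove duplicates. -/
def nub {β : Type} [DecidableEq β] (l : List β) : List β :=
  l.foldl (fun acc y => if y ∈ acc then acc else y :: acc) []

theorem nub_spec {β : Type} [DecidableEq β] (l : List β) :
    (nub l).Nodup ∧ ∀ y, y ∈ nub l ↔ y ∈ l := by
  have key : ∀ (l acc : List β), acc.Nodup →
      (l.foldl (fun acc y => if y ∈ acc then acc else y :: acc) acc).Nodup ∧
      ∀ y, y ∈ l.foldl (fun acc y => if y ∈ acc then acc else y :: acc) acc ↔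
        y ∈ l ∨ y ∈ acc := by
    intro l
    induction l with
    | nil => intro acc h; simp [h]
    | cons a l ih =>
      intro acc h
      by_cases ha : a ∈ acc
      · obtain ⟨h₁, h₂⟩ := ih acc h
        simp only [List.foldl_cons, if_pos ha, List.mem_cons]
        refine ⟨h₁, fun y => ?_⟩
        rw [h₂]
        constructor
        · tauto
        · rintro ((rfl | h) | h) <;> tauto
      · obtain ⟨h₁, h₂⟩ := ih (a :: acc) (List.nodup_cons.2 ⟨ha, h⟩)
        simp only [List.foldl_cons, if_neg ha, List.mem_cons]
        refine ⟨h₁, fun y => ?_⟩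
        rw [h₂, List.mem_cons]
        tauto
  simpa [nub] using key l [] List.nodup_nil

/-- The flag records whether an occurrence has been skipped; the kept elements accumulate in reverse
order. In this form, erasing is a fold whose accumulator grows by a bounded amount per element. -/
theorem foldl_erase {β : Type} [DecidableEq β] [BEq β] [LawfulBEq β] (b : β) (l : List β) :
    (l.foldl (fun (acc : Bool × List β) y =>
      if acc.1 = false ∧ y = b then (true, acc.2) else (acc.1, y :: acc.2)) (false, [])).2.reverse =
      l.erase b := by
  have h₁ : ∀ (l r : List β), (l.foldl (fun (acc : Bool × List β) y =>
      if acc.1 = false ∧ y = b then (true, acc.2) else (acc.1, y :: acc.2)) (true, r)).2 =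
      l.reverse ++ r := by
    intro l
    induction l with
    | nil => simp
    | cons a l ih => intro r; simpa using ih (a :: r)
  have h₂ : ∀ (l r : List β), (l.foldl (fun (acc : Bool × List β) y =>
      if acc.1 = false ∧ y = b then (true, acc.2) else (acc.1, y :: acc.2)) (false, r)).2 =
      (l.erase b).reverse ++ r := by
    intro l
    induction l with
    | nil => simp
    | cons a l ih =>
      intro r
      by_cases h : a = b
      · subst h
        have := h₁ l r
        simpa using this
      · have := ih (a :: r)
        rw [List.erase_cons_tail (by simpa using h)]
        simpa [h] using this
  rw [h₂]
  simp

namespace PolyTime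

variable {α β γ δ : Type} [Enc α] [Enc β] [Enc γ] [Enc δ]

theorem restrict {f : α → β} (hf : PolyTime f) (p : α → Prop) :
    PolyTime fun x : {x // p x} => f x :=
  hf.of_enc (fun x => x.1) (fun _ => rfl) fun _ => rfl

theorem encode {f : α → β} (hf : PolyTime f) : PolyTime fun x => enc (f x) :=
  hf.of_enc (fun x => x) (fun _ => rfl) fun _ => rfl

/-- A nonempty tree already is the code of the pair of its components, so splitting it costs
nothing. The case distinctions on lists, options, numbers and truth values all follow from this one.
-/
theorem data_cases {c : α → Data} (hc : PolyTime c) {f g : α → δ} (hg : PolyTime g)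
    (u : {x // c x ≠ .nil} → β) (v : {x // c x ≠ .nil} → γ)
    (huv : ∀ x, c x.1 = .cons (enc (u x)) (enc (v x)))
    {h : α × β × γ → δ} (hh : PolyTime h)
    (h₁ : ∀ x, c x = .nil → f x = g x) (h₂ : ∀ x, f x.1 = h (x.1, u x, v x)) : PolyTime f := by
  refine ite_nil hc ((hg.restrict _).of_enc (fun x => x) (fun _ => rfl) fun x => ?_) ?_
  · rw [h₁ x.1 x.2]
  · have hu : PolyTime fun x : {x // c x ≠ .nil} => (x, c x) := id.pair (hc.restrict _)
    refine (hh.comp ((id.restrict _).pair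
      ((hc.restrict _).of_enc (f := fun x => (u x, v x)) (fun x => x) (fun _ => rfl) ?_))).of_enc
      (fun x => x) (fun _ => rfl) fun x => ?_
    · exact fun x => (huv x).symm
    · rw [h₂ x]

theorem list_cases {l : α → List β} (hl : PolyTime l) {f g : α → δ} (hg : PolyTime g)
    {h : α × β × List β → δ} (hh : PolyTime h) (h₁ : ∀ x, l x = [] → f x = g x)
    (h₂ : ∀ x y t, l x = y :: t → f x = h (x, y, t)) : PolyTime f := by
  have ne : ∀ x : {x // enc (l x) ≠ .nil}, l x ≠ [] := fun x hx => x.2 (by rw [hx]; rfl)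
  refine data_cases hl.encode hg (fun x => (l x).head (ne x)) (fun x => (l x).tail) (fun x => ?_)
    hh (fun x hx => h₁ x (Enc.inj hx)) fun x => h₂ _ _ _ (by simp)
  conv_lhs => rw [← List.cons_head_tail (ne x)]
  rfl

theorem option_cases {l : α → Option β} (hl : PolyTime l) {f g : α → δ} (hg : PolyTime g)
    {h : α × β → δ} (hh : PolyTime h) (h₁ : ∀ x, l x = none → f x = g x)
    (h₂ : ∀ x y, l x = some y → f x = h (x, y)) : PolyTime f := by
  have ne : ∀ x : {x // enc (l x) ≠ .nil}, (l x).isSome := fun x => by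
    have := x.2
    cases h : l x.1 <;> simp_all
  refine data_cases (β := Unit) hl.encode hg (fun _ => ()) (fun x => (l x).get (ne x))
    (fun x => ?_) (hh.comp (fst.pair (snd.comp snd))) (fun x hx => h₁ x (Enc.inj hx))
    fun x => h₂ _ _ (by simp)
  conv_lhs => rw [← Option.some_get (ne x)]
  rfl

theorem nat_cases {l : α → ℕ} (hl : PolyTime l) {f g : α → δ} (hg : PolyTime g)
    {h : α × ℕ → δ} (hh : PolyTime h) (h₁ : ∀ x, l x = 0 → f x = g x)
    (h₂ : ∀ x n, l x = n + 1 → f x = h (x, n)) : PolyTime f := by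
  have ne : ∀ x : {x // enc (l x) ≠ .nil}, l x = l x - 1 + 1 := fun x => by
    have := x.2
    cases h : l x.1 <;> simp_all
  refine data_cases (β := Unit) hl.encode hg (fun _ => ()) (fun x => l x - 1)
    (fun x => ?_) (hh.comp (fst.pair (snd.comp snd))) (fun x hx => h₁ x (Enc.inj hx))
    fun x => h₂ _ _ (ne x)
  conv_lhs => rw [ne x]
  rfl

theorem ite {p : α → Prop} [DecidablePred p] (hp : PolyTime fun x => decide (p x)) {f g : α → β}
    (hf : PolyTime f) (hg : PolyTime g) : PolyTime fun x => if p x then f x else g x := by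
  refine data_cases (β := Unit) (γ := Unit) hp.encode hg (fun _ => ()) (fun _ => ()) (fun x => ?_)
    (hf.comp fst) (fun x hx => ?_) fun x => ?_
  · have := x.2
    by_cases h : p x.1 <;> simp_all
  · by_cases h : p x <;> simp_all
  · have := x.2
    by_cases h : p x.1 <;> simp_all

theorem decide_and {p q : α → Prop} [DecidablePred p] [DecidablePred q]
    (hp : PolyTime fun x => decide (p x)) (hq : PolyTime fun x => decide (q x)) :
    PolyTime fun x => decide (p x ∧ q x) := by
  refine (ite hp hq (const false)).of_enc (fun x => x) (fun _ => rfl) fun x => ?_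
  by_cases h : p x <;> simp [h]

theorem foldl {l : α → List β} {i : α → γ} {h : α → γ → β → γ} (hl : PolyTime l)
    (hi : PolyTime i) (hh : PolyTime fun p : α × γ × β => h p.1 p.2.1 p.2.2)
    {B : ℕ → ℕ} (hB : PolyBdd B)
    (hb : ∀ x l₁ l₂, l x = l₁ ++ l₂ → sz (l₁.foldl (h x) (i x)) ≤ B (sz x)) :
    PolyTime fun x => (l x).foldl (h x) (i x) :=
  foldl_mem hl hi (hh.restrict _) hB hb

theorem exists_sz_le {f : α → β} (hf : PolyTime f) : ∃ k, ∀ x, sz (f x) ≤ sz x + (sz x + 2) ^ k :=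
  let ⟨_, k, h⟩ := hf
  ⟨k, sz_le h⟩

/-- If the growth in each step is bounded independently of the accumulator, the final size is at
most the initial size plus the length of the list times this growth. The bound required by
`foldl_mem` is then automatic. -/
theorem foldl_add_mem {l : α → List β} {i : α → γ} {h : α → γ → β → γ} (hl : PolyTime l)
    (hi : PolyTime i)
    (hh : PolyTime fun p : {p : α × γ × β // p.2.2 ∈ l p.1} => h p.1.1 p.1.2.1 p.1.2.2)
    {G : ℕ → ℕ} (hG : PolyBdd G) (hm : Monotone G)
    (hb : ∀ x r, ∀ y ∈ l x, sz (h x r y) ≤ sz r + G (sz (x, y))) :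
    PolyTime fun x => (l x).foldl (h x) (i x) := by
  obtain ⟨k, hk⟩ := hl.exists_sz_le
  obtain ⟨m, hm'⟩ := hi.exists_sz_le
  refine foldl_mem hl hi hh (B := fun n => n + (n + 2) ^ m +
    (n + (n + 2) ^ k) * G (n + (n + (n + 2) ^ k) + 1)) ?_ fun x l₁ l₂ e => ?_
  · have h₁ : PolyBdd fun n => n + (n + 2) ^ k := PolyBdd.id.add (.pow_self k)
    exact (PolyBdd.id.add (.pow_self m)).add (h₁.mul (hG.comp ((PolyBdd.id.add h₁).add (.const 1))))
  · have key : ∀ l₁ : List β, (∀ y ∈ l₁, y ∈ l x) → ∀ r, sz (l₁.foldl (h x) r) ≤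
        sz r + l₁.length * G (sz x + (sz x + (sz x + 2) ^ k) + 1) := by
      intro l₁
      induction l₁ with
      | nil => intro _ r; simp
      | cons y l₁ ih =>
        intro hy r
        have h₁ := ih (fun z hz => hy z (by simp [hz])) (h x r y)
        have h₂ := hb x r y (hy y (by simp))
        have h₃ : G (sz (x, y)) ≤ G (sz x + (sz x + (sz x + 2) ^ k) + 1) := by
          apply hm
          have := sz_le_of_mem (hy y (by simp))
          have := hk x
          simp; omega
        simp only [List.foldl_cons, List.length_cons, add_mul, one_mul]
        omega
    have h₁ := key l₁ (fun y hy => by rw [e]; simp [hy]) (i x)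
    have h₂ : l₁.length ≤ sz x + (sz x + 2) ^ k := by
      have h₃ := hk x
      have h₄ := length_le_sz (l x)
      rw [e] at h₃ h₄
      rw [List.length_append] at h₄
      omega
    have h₃ := Nat.mul_le_mul_right (G (sz x + (sz x + (sz x + 2) ^ k) + 1)) h₂
    have h₄ := hm' x
    omega

theorem foldl_add {l : α → List β} {i : α → γ} {h : α → γ → β → γ} (hl : PolyTime l)
    (hi : PolyTime i) (hh : PolyTime fun p : α × γ × β => h p.1 p.2.1 p.2.2)
    {G : ℕ → ℕ} (hG : PolyBdd G) (hm : Monotone G)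
    (hb : ∀ x r y, sz (h x r y) ≤ sz r + G (sz (x, y))) :
    PolyTime fun x => (l x).foldl (h x) (i x) :=
  foldl_add_mem hl hi (hh.restrict _) hG hm fun x r y _ => hb x r y

theorem cons {f : α → β} {l : α → List β} (hf : PolyTime f) (hl : PolyTime l) :
    PolyTime fun x => f x :: l x :=
  (hf.pair hl).of_enc (fun x => x) (fun _ => rfl) fun _ => rfl

theorem optionSome {f : α → β} (hf : PolyTime f) : PolyTime fun x => some (f x) :=
  ((const ()).pair hf).of_enc (fun x => x) (fun _ => rfl) fun _ => rfl

theorem foldl_cons {f g : α → List β} (hf : PolyTime f) (hg : PolyTime g) :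
    PolyTime fun x => (f x).foldl (fun acc y => y :: acc) (g x) := by
  refine foldl_add hf hg ((snd.comp snd).cons (fst.comp snd)) (G := fun n => n) .id monotone_id ?_
  intro x r y
  simp; omega

theorem reverse {f : α → List β} (hf : PolyTime f) : PolyTime fun x => (f x).reverse := by
  simpa only [List.foldl_flip_cons_eq_append', List.append_nil] using hf.foldl_cons (const [])

theorem append {f g : α → List β} (hf : PolyTime f) (hg : PolyTime g) :
    PolyTime fun x => f x ++ g x := by
  simpa only [List.foldl_flip_cons_eq_append', List.reverse_reverse] using
    hf.reverse.foldl_cons hg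

theorem flatMap_mem {l : α → List β} {g : α → β → List γ} (hl : PolyTime l)
    (hg : PolyTime fun p : {p : α × β // p.2 ∈ l p.1} => g p.1.1 p.1.2) :
    PolyTime fun x => (l x).flatMap (g x) := by
  obtain ⟨k, hk⟩ := hg.exists_sz_le
  have hq : PolyTime fun p : {p : α × List γ × β // p.2.2 ∈ l p.1} =>
      (⟨(p.1.1, p.1.2.2), p.2⟩ : {p : α × β // p.2 ∈ l p.1}) :=
    (((fst.pair (snd.comp snd)).restrict fun p : α × List γ × β => p.2.2 ∈ l p.1)).of_enc
      (fun x => x) (fun _ => rfl) fun _ => rfl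
  have := foldl_add_mem hl (i := fun _ => ([] : List γ)) (h := fun x acc y => acc ++ g x y)
    (const []) (((fst.comp snd).restrict _).append (hg.comp hq))
    (G := fun n => n + (n + 2) ^ k) (PolyBdd.id.add (.pow_self k))
    (fun m n h => by dsimp only; gcongr) (fun x r y hy => by
      have h₁ := sz_append r (g x y)
      have h₂ := hk ⟨(x, y), hy⟩
      simp only [sz_sub] at h₂
      omega)
  simpa only [List.flatMap_eq_foldl] using this

theorem flatMap {l : α → List β} {g : α × β → List γ} (hl : PolyTime l) (hg : PolyTime g) :
    PolyTime fun x => (l x).flatMap fun y => g (x, y) :=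
  flatMap_mem hl (hg.restrict _)

theorem map_mem {l : α → List β} {g : α → β → γ} (hl : PolyTime l)
    (hg : PolyTime fun p : {p : α × β // p.2 ∈ l p.1} => g p.1.1 p.1.2) :
    PolyTime fun x => (l x).map (g x) := by
  have := flatMap_mem (g := fun x y => [g x y]) hl (hg.cons (const []))
  simpa only [← List.map_eq_flatMap] using this

theorem map {l : α → List β} {g : α × β → γ} (hl : PolyTime l) (hg : PolyTime g) :
    PolyTime fun x => (l x).map fun y => g (x, y) :=
  map_mem hl (hg.restrict _)

theorem mem [DecidableEq β] {f : α → β} {l : α → List β} (hf : PolyTime f) (hl : PolyTime l) :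
    PolyTime fun x => decide (f x ∈ l x) := by
  have := foldl_add hl (i := fun _ => false)
    (h := fun x acc y => if acc = true then true else decide (f x = y)) (const false)
    (ite (decide_eq (fst.comp snd) (const true)) (const true)
      (decide_eq (hf.comp fst) (snd.comp snd))) (G := fun _ => 3) (.const 3) monotone_const
    (fun x r y => (sz_bool _).trans (by omega))
  refine this.of_enc (fun x => x) (fun _ => rfl) fun x => congrArg enc ?_
  have key : ∀ (l : List β) (b : Bool),
      l.foldl (fun acc y => if acc = true then true else decide (f x = y)) b =
        (b || decide (f x ∈ l)) := by
    intro l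
    induction l with
    | nil => simp
    | cons y l ih =>
      intro b
      rw [List.foldl_cons, ih]
      cases b <;> simp
  rw [key]
  simp

theorem nub [DecidableEq β] {l : α → List β} (hl : PolyTime l) : PolyTime fun x => nub (l x) := by
  refine foldl_add hl (const []) (ite (mem (snd.comp snd) (fst.comp snd)) (fst.comp snd)
    ((snd.comp snd).cons (fst.comp snd))) (G := fun n => n) .id monotone_id ?_
  intro x r y
  split_ifs <;> simp
  omega

theorem erase [DecidableEq β] [BEq β] [LawfulBEq β] {l : α → List β} {f : α → β} (hl : PolyTime l)
    (hf : PolyTime f) : PolyTime fun x => (l x).erase (f x) := by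
  simp only [← foldl_erase]
  refine (snd.comp (foldl_add hl (const (false, [])) ?_ (G := fun n => n + 3)
    (PolyBdd.id.add (.const 3))
    (fun m n h => by dsimp only; gcongr) ?_)).reverse
  · exact ite (decide_and (decide_eq (fst.comp (fst.comp snd)) (const false))
      (decide_eq (snd.comp snd) (hf.comp fst))) ((const true).pair (snd.comp (fst.comp snd)))
      ((fst.comp (fst.comp snd)).pair ((snd.comp snd).cons (snd.comp (fst.comp snd))))
  · intro x r y
    have := sz_bool r.1
    have := sz_bool true
    have := sz_pos r.1
    obtain ⟨b, r⟩ := r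
    dsimp only
    split_ifs <;> simp at * <;> omega

theorem tail {l : α → List β} (hl : PolyTime l) : PolyTime fun x => (l x).tail :=
  hl.list_cases (const []) (snd.comp snd) (fun x h => by rw [h]; rfl)
    fun x y t h => by rw [h]; rfl

theorem headD {l : α → List β} (hl : PolyTime l) (y : β) : PolyTime fun x => (l x).headD y :=
  hl.list_cases (const y) (fst.comp snd) (fun x h => by rw [h]; rfl)
    fun x y t h => by rw [h]; rfl

theorem getElem? {l : α → List β} (hl : PolyTime l) (i : ℕ) : PolyTime fun x => (l x)[i]? := by
  induction i generalizing l with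
  | zero =>
    exact hl.list_cases (const none) (fst.comp snd).optionSome (fun x h => by rw [h]; rfl)
      fun x y t h => by rw [h]; rfl
  | succ i ih => simpa using ih hl.tail

theorem set {l : α → List β} {f : α → β} (hl : PolyTime l) (hf : PolyTime f) (i : ℕ) :
    PolyTime fun x => (l x).set i (f x) := by
  have key : PolyTime fun p : List β × β => p.1.set i p.2 := by
    clear hl hf
    induction i with
    | zero =>
      exact fst.list_cases (const []) ((snd.comp fst).cons (snd.comp snd))
        (fun x h => by rw [h]; rfl) fun x y t h => by rw [h]; rfl
    | succ i ih =>
      exact fst.list_cases (const [])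
        ((fst.comp snd).cons (ih.comp ((snd.comp snd).pair (snd.comp fst))))
        (fun x h => by rw [h]; rfl) fun x y t h => by rw [h]; rfl
  exact key.comp (hl.pair hf)

/-- Since `n` is fixed, the loop is unrolled: the program contains a separate copy for each index.
-/
theorem range_flatMap {f : ℕ → α → List β} (hf : ∀ i, PolyTime (f i)) (n : ℕ) :
    PolyTime fun x => (List.range n).flatMap fun i => f i x := by
  induction n with
  | zero => exact const []
  | succ n ih => simpa [List.range_succ] using ih.append (hf n)

/-- A unary number has the same tree as a list of that many units, so addition is concatenation. -/
theorem add {f g : α → ℕ} (hf : PolyTime f) (hg : PolyTime g) :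
    PolyTime fun x => f x + g x := by
  have key : ∀ n : ℕ, enc n = enc (List.replicate n ()) := by
    intro n
    induction n with
    | zero => rfl
    | succ n ih => simp [List.replicate_succ, ih]
  have hf' : PolyTime fun x => List.replicate (f x) () :=
    hf.of_enc (fun x => x) (fun _ => rfl) fun x => (key _).symm
  have hg' : PolyTime fun x => List.replicate (g x) () :=
    hg.of_enc (fun x => x) (fun _ => rfl) fun x => (key _).symm
  refine (hf'.append hg').of_enc (fun x => x) (fun _ => rfl) fun x => ?_
  rw [key, List.replicate_append_replicate]

theorem pred {f : α → ℕ} (hf : PolyTime f) : PolyTime fun x => f x - 1 :=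
  hf.nat_cases (const 0) snd (fun x h => by rw [h]) fun x n h => by rw [h]; rfl

end PolyTime

end BusOut

/-! ### Input strings as trees, and the passage to machines. -/

namespace BusOut

open Computability Turing Enc Prog

/-- The number of a symbol. -/
def symIndex : Γ' → ℕ
  | .blank => 0
  | .bit false => 1
  | .bit true => 2
  | .bra => 3
  | .ket => 4
  | .comma => 5

instance : Enc Γ' := ⟨fun x => enc (symIndex x), fun x y h => by
  have h := Enc.inj h
  rcases x with _ | (_ | _) | _ | _ | _ <;> rcases y with _ | (_ | _) | _ | _ | _ <;>
    simp_all [symIndex]⟩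

theorem sz_symbol (x : Γ') : sz x ≤ 11 := by
  have : sz x = 2 * symIndex x + 1 := sz_nat _
  have h : symIndex x ≤ 5 := by rcases x with _ | (_ | _) | _ | _ | _ <;> simp [symIndex]
  omega

/-- A type whose elements are coded by strings, which are read from the end. -/
abbrev encOfString {α : Type} (e : α → List Γ') (he : Function.Injective e) : Enc α :=
  ⟨fun x => enc (e x).reverse, fun _ _ h => he (List.reverse_injective (Enc.inj h))⟩

namespace Prog

/-- Push a tree and the first symbol of a pair, according to the symbol in the first register. -/
def pushCase : List Γ' → Prog
  | [] => reset
  | x :: L => .ite (fun v => v.1 == some x) (pushWord (.bit true :: (enc x).code)) (pushCase L)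

/-- The leading bit makes the list below the tail of a new list with head `x`. The pushed word has
at most 12 symbols, and resetting the registers adds one step. -/
theorem pushCase_runs (x : Γ') (z : Option Γ') (d a b c : List Γ') (o : List Bool) (L : List Γ')
    (hx : x ∈ L) : Runs (pushCase L) ((some x, z), mem d a b c o)
      ((none, none), mem (.bit true :: ((enc x).code ++ d)) a b c o) (L.length + 13) := by
  induction L with
  | nil => simp at hx
  | cons y L ih =>
    by_cases h : x = y
    · subst h
      refine (Runs.ite_true (by simp) (Op.pushWord_runs _ _ _ _ _ _ _)).mono ?_
      have := sz_symbol x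
      simp only [sz, Data.size] at this
      simp; omega
    · exact (Runs.ite_false (by simpa using h) (ih (by simpa [h] using hx))).mono
        (by simp)

/-- Read a string and build the tree of its list of symbols, reversed. -/
def readInput : Prog :=
  .push .d (fun _ => .bit false) ;; popA ;;
    .loop (fun v => v.1.isSome)
      (pushCase [.blank, .bit false, .bit true, .bra, .ket, .comma] ;; popA) ;; reset

/-- Putting each symbol in front of the list reverses the string, which is why `encOfString`
contains a reversal. -/
theorem readInput_runs (w : List Γ') :
    Runs readInput ((none, none), mem [] w [] [] [])
      ((none, none), mem (codes [enc w.reverse]) [] [] [] []) (21 * w.length + 4) := by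
  have key : ∀ w u : List Γ',
      Runs (.loop (fun v => v.1.isSome)
        (pushCase [.blank, .bit false, .bit true, .bra, .ket, .comma] ;; popA))
        ((w.head?, none), mem (enc u).code w.tail [] [] [])
        ((none, none), mem (enc (w.reverse ++ u)).code [] [] [] []) (21 * w.length + 1) := by
    intro w
    induction w with
    | nil => exact fun u => Runs.loop_exit rfl
    | cons x w ih =>
      intro u
      have h₁ := pushCase_runs x none (enc u).code w [] [] []
        [.blank, .bit false, .bit true, .bra, .ket, .comma]
        (by rcases x with _ | (_ | _) | _ | _ | _ <;> simp)
      have h₂ := ih (x :: u)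
      refine (Runs.loop_step rfl (h₁.seq (Runs.pop_a _ _ _ _ _ _ _))
        (by simpa [Data.code, popA] using h₂)).mono ?_
      simp only [List.length_cons, List.length_nil]
      omega
  have h₁ := key w []
  simp only [List.append_nil] at h₁
  simp only [codes, List.append_nil]
  refine ((Runs.push_d _ _ _ _ _ _ _).seq ((Runs.pop_a _ _ _ _ _ _ _).seq
    (h₁.seq (Runs.load _ _ _)))).mono ?_
  omega

end Prog

theorem PolyBdd.exists_polynomial {g : ℕ → ℕ} (hg : PolyBdd g) :
    ∃ T : Polynomial ℕ, ∀ n, g n ≤ T.eval n := by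
  obtain ⟨k, hk⟩ := hg
  exact ⟨(Polynomial.X + 2) ^ k, fun n => by simpa using hk n⟩

theorem decidableInPolyTime_of_polyTime {α : Type} (e : α → List Γ') (he : Function.Injective e)
    (P : α → Prop) (f : α → Bool) (hf : ∀ x, f x = true ↔ P x)
    (h : letI := encOfString e he; PolyTime f) : DecidableInPolyTime e P := by
  let _ := encOfString e he
  obtain ⟨p, k, hp⟩ : PolyTime f := h
  have hB : PolyBdd fun n => (21 * n + 4) + ((12 * n + 1 + 2) ^ k + 50) :=
    (((PolyBdd.const 21).mul .id).add (.const 4)).add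
      (((((PolyBdd.const 12).mul .id).add (.const 1)).comp_pow k).add (.const 50))
  obtain ⟨T, hT⟩ := hB.exists_polynomial
  refine decidableInPolyTime_of_exec e P f hf (readInput ;; p ;; peek ;;
    .push .o (fun v => v.1 == some (.bit true)) ;; reset ;; drop) T fun x => ?_
  refine Runs.mono (n := T.eval (e x).length) ?_ (hT _)
  have h₁ : Runs (.push .o fun v => v.1 == some (.bit true))
      ((some (enc (f x)).tag, none), mem (codes [enc (f x)]) [] [] [] [])
      ((some (enc (f x)).tag, none), mem (codes [enc (f x)]) [] [] [] [f x]) 1 := by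
    cases f x <;> exact Runs.push_o _ _ _ _ _ _ _
  refine ((readInput_runs (e x)).seq ((hp x [] [] [] []).seq ((Op.peek_runs _ _ _).seq
    (h₁.seq ((Runs.load _ _ _).seq (Op.drop [] [] [f x])))))).mono ?_
  -- Each symbol contributes a tree of size at most 11 and one list node.
  have h₂ : sz x ≤ 12 * (e x).length + 1 := by
    have : sz (e x).reverse ≤ (e x).reverse.length * (11 + 1) + 1 :=
      sz_le_of_forall fun y _ => sz_symbol y
    rw [List.length_reverse] at this
    exact this.trans (by omega)
  have h₃ : (sz x + 2) ^ k ≤ (12 * (e x).length + 1 + 2) ^ k := by gcongr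
  have h₄ : (enc (f x)).size ≤ 3 := sz_bool _
  omega

end BusOut

namespace BusOut

open Finset

/-! ### The number of reachable configurations -/

namespace Config

variable {s : ℕ}

/-- The buses in the traffic. -/
def labels (C : Config s) : Multiset Bus := (List.ofFn C.graph.label : Multiset Bus)

/-- The number of seats at a parking spot. -/
def spotSeats (b : Option Bus) : ℕ := b.elim 0 fun b => (b.2 : ℕ)

/-- The total number of seats. -/
def totalSeats (C : Config s) : ℕ :=
  (C.labels.map fun b => (b.2 : ℕ)).sum + ∑ i, spotSeats (C.spots i)

theorem _root_.BusOut.CongestionGraph.cons_labels_remove {m : ℕ} (G : CongestionGraph (m + 1))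
    (u : Fin (m + 1)) :
    G.label u ::ₘ (List.ofFn (G.remove u).label : Multiset Bus) = List.ofFn G.label := by
  rw [← Fin.univ_val_map, ← Fin.univ_val_map, Fin.univ_succAbove _ u]
  simp [CongestionGraph.remove]
  rfl

theorem sum_update_add {ι β : Type*} [Fintype ι] [DecidableEq ι] (g : β → ℕ) (S : ι → β) (i : ι)
    (y : β) : ∑ j, g (Function.update S i y j) + g (S i) = ∑ j, g (S j) + g y := by
  rw [← Finset.add_sum_erase univ _ (mem_univ i), ← Finset.add_sum_erase univ (fun j => g (S j))
    (mem_univ i), Function.update_self]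
  have : ∑ j ∈ univ.erase i, g (Function.update S i y j) = ∑ j ∈ univ.erase i, g (S j) :=
    Finset.sum_congr rfl fun j hj => by rw [Function.update_of_ne (Finset.ne_of_mem_erase hj)]
  omega

/-- The properties of a configuration `D` that is reachable from `C`. -/
structure Below (C D : Config s) : Prop where
  labels_le : D.labels ≤ C.labels
  spots : ∀ i x k, D.spots i = some (x, k) → ∃ l, (x, l) ∈ C.labels ∧ k ≤ l
  suffix : D.queue <:+ C.queue
  seats : D.totalSeats = D.queue.length

theorem Below.step {C D E : Config s} (h : Below C D) (hs : Step D E) : Below C E := by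
  obtain ⟨h₁, h₂, h₃, h₄⟩ := h
  cases hs with
  | @dispatch m G Q S u i hfree hspot hwait =>
    have hl := G.cons_labels_remove u
    have hmem : G.label u ∈ C.labels :=
      Multiset.mem_of_le h₁ (by simp only [labels]; rw [← hl]; simp)
    refine ⟨le_trans ?_ h₁, fun j x k hj => ?_, h₃, ?_⟩
    · simp only [labels]
      rw [← hl]
      exact Multiset.le_cons_self _ _
    · by_cases hij : j = i
      · subst hij
        simp only [Function.update_self, Option.some.injEq] at hj
        exact ⟨k, hj ▸ hmem, le_rfl⟩
      · simp only [Function.update_of_ne hij] at hj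
        exact h₂ j x k hj
    · have := sum_update_add spotSeats S i (some (G.label u))
      simp only [totalSeats, labels] at h₄ ⊢
      rw [← hl] at h₄
      simp only [hspot, spotSeats, Option.elim, Multiset.map_cons, Multiset.sum_cons] at this h₄ ⊢
      omega
  | @board m G x Q S i k hspot =>
    refine ⟨h₁, fun j y l hj => ?_, (List.suffix_cons x Q).trans h₃, ?_⟩
    · by_cases hij : j = i
      · subst hij
        simp only [Function.update_self, Option.some.injEq, Prod.mk.injEq] at hj
        obtain ⟨rfl, rfl⟩ := hj
        obtain ⟨l, hl, hk⟩ := h₂ j _ _ hspot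
        exact ⟨l, hl, le_trans (PNat.lt_add_right k 1).le hk⟩
      · simp only [Function.update_of_ne hij] at hj
        exact h₂ j y l hj
    · have := sum_update_add spotSeats S i (some (x, k))
      simp only [totalSeats, labels, List.length_cons] at h₄ ⊢
      simp only [hspot, spotSeats, Option.elim, PNat.add_coe, PNat.val_ofNat] at this h₄ ⊢
      omega
  | @boardLast m G x Q S i hspot =>
    refine ⟨h₁, fun j y l hj => ?_, (List.suffix_cons x Q).trans h₃, ?_⟩
    · by_cases hij : j = i
      · subst hij
        simp at hj
      · simp only [Function.update_of_ne hij] at hj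
        exact h₂ j y l hj
    · have := sum_update_add spotSeats S i none
      simp only [totalSeats, labels, List.length_cons] at h₄ ⊢
      simp only [hspot, spotSeats, Option.elim, PNat.val_ofNat] at this h₄ ⊢
      omega

/-- Eligibility is an equality for each color. Summing it over a finite set `F` that contains the
colors of all buses and passengers gives the equality of totals. -/
theorem Below.refl {C : Config s} (he : C.Eligible) (hs : C.SpotsEmpty) : Below C C := by
  refine ⟨le_rfl, fun i x k h => ?_, List.suffix_refl _, ?_⟩
  · rw [hs i] at h; cases h
  · have h₀ : ∑ i, spotSeats (C.spots i) = 0 :=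
      Finset.sum_eq_zero fun i _ => by rw [hs i]; rfl
    let F : Finset Color := univ.image (fun u => (C.graph.label u).1) ∪ C.queue.toFinset
    have h₁ : ∑ x ∈ F, C.queue.count x = C.queue.length := by
      have := Multiset.sum_count_eq_card (s := F) (m := (C.queue : Multiset Color))
        fun a ha => by simp at ha; simp [F, ha]
      simpa using this
    have h₂ : ∑ x ∈ F, C.seats x = ∑ u, ((C.graph.label u).2 : ℕ) := by
      simp only [Config.seats, hs _, Option.elim, Finset.sum_const_zero, add_zero]
      rw [Finset.sum_comm]
      refine Finset.sum_congr rfl fun u _ => ?_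
      rw [Finset.sum_ite_eq, if_pos]
      simp [F]
    rw [totalSeats, h₀, add_zero, labels, ← h₁, ← Finset.sum_congr rfl fun x _ => he.2 x, h₂,
      ← Fin.univ_val_map, Multiset.map_map]
    rfl

theorem Below.of_reaches {C D : Config s} (he : C.Eligible) (hs : C.SpotsEmpty)
    (h : C.Reaches D) : Below C D := by
  induction h with
  | refl => exact .refl he hs
  | tail _ hstep ih => exact ih.step hstep

/-- Equal traffic and spots have equally many seats, hence the queues have the same length; two
suffixes of one list with the same length coincide. -/
theorem Below.queue_eq {C D E : Config s} (hD : Below C D) (hE : Below C E)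
    (hl : D.labels = E.labels) (hs : D.spots = E.spots) : D.queue = E.queue := by
  have h : D.queue.length = E.queue.length := by
    rw [← hD.seats, ← hE.seats, totalSeats, totalSeats, hl, hs]
  exact (List.suffix_of_suffix_length_le hD.suffix hE.suffix h.le).eq_of_length h

/-- The vertices with a given label are equally numerous on both sides, and bijections between these
fibers are glued. -/
theorem exists_equiv_of_labels_eq {C D : Config s} (h : C.labels = D.labels) :
    ∃ e : Fin C.size ≃ Fin D.size, ∀ u, D.graph.label (e u) = C.graph.label u := by
  have key : ∀ (E : Config s) (b : Bus),
      Fintype.card {u // E.graph.label u = b} = E.labels.count b := by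
    intro E b
    rw [labels, ← Fin.univ_val_map, Multiset.count_map, Fintype.card_subtype]
    simp only [Finset.card_def, Finset.filter_val, eq_comm]
  exact ⟨Equiv.ofFiberEquiv fun b => Fintype.equivOfCardEq (by rw [key, key, h]),
    fun u => Equiv.ofFiberEquiv_map _ u⟩

theorem count_mul_le (C : Config s) (b : Bus) :
    C.labels.count b * (b.2 : ℕ) ≤ C.totalSeats := by
  have h : Multiset.replicate (C.labels.count b) b ≤ C.labels :=
    Multiset.le_count_iff_replicate_le.1 le_rfl
  obtain ⟨u, hu⟩ := Multiset.le_iff_exists_add.1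
    (Multiset.map_le_map (f := fun b : Bus => (b.2 : ℕ)) h)
  have h₁ := congrArg Multiset.sum hu
  simp only [Multiset.map_replicate, Multiset.sum_add, Multiset.sum_replicate, smul_eq_mul] at h₁
  rw [Config.totalSeats]
  omega

end Config

/-- Let `t` maximize `g`, so that the base of the `s`-th power is at most `(c + 1) * g t`. One
factor `g t` is absorbed by `(f t + 1) * g t ≤ 2 * N`, the other `s - 1` are at most `N`, and the
remaining labels contribute at most `(2 * N) ^ (c - 1)`. The total exponent `s + c - 1` is at most
`s * c`. -/
theorem prod_succ_mul_pow_le {ι : Type*} [DecidableEq ι] (T : Finset ι) (f g : ι → ℕ) (s c N : ℕ)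
    (hs : 0 < s) (hc : 0 < c) (hN : 0 < N) (hT : #T ≤ c) (hf : ∀ t ∈ T, 0 < f t)
    (hg : ∀ t ∈ T, 0 < g t) (h : ∀ t ∈ T, f t * g t ≤ N) :
    (∏ t ∈ T, (f t + 1)) * (1 + ∑ t ∈ T, g t) ^ s ≤ (c + 1) ^ s * 2 ^ c * N ^ (s * c) := by
  have hN' : ∀ t ∈ T, f t + 1 ≤ 2 * N := fun t ht => by
    have h₁ := h t ht
    have h₂ := Nat.le_mul_of_pos_right (f t) (hg t ht)
    omega
  have hpow : ∀ k, k ≤ s * c → N ^ k ≤ N ^ (s * c) := fun k hk => Nat.pow_le_pow_right hN hk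
  rcases T.eq_empty_or_nonempty with rfl | hne
  · simp only [prod_empty, sum_empty, add_zero, one_pow, mul_one]
    exact Nat.succ_le_of_lt (by positivity)
  · obtain ⟨t, ht, hmax⟩ := T.exists_max_image g hne
    have h₁ : 1 + ∑ t ∈ T, g t ≤ (c + 1) * g t := by
      have h₂ : ∑ t ∈ T, g t ≤ #T * g t := by simpa using Finset.sum_le_card_nsmul T g (g t) hmax
      have h₃ := Nat.mul_le_mul_right (g t) hT
      have h₄ := hg t ht
      rw [add_mul]
      omega
    have h₂ : ∏ t ∈ T.erase t, (f t + 1) ≤ (2 * N) ^ (c - 1) := by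
      refine (Finset.prod_le_pow_card _ _ (2 * N) fun x hx =>
        hN' x (Finset.mem_of_mem_erase hx)).trans ?_
      refine Nat.pow_le_pow_right (by omega) ?_
      rw [Finset.card_erase_of_mem ht]
      omega
    have h₃ : (f t + 1) * g t ≤ 2 * N := by
      have h₄ := h t ht
      have h₅ := Nat.le_mul_of_pos_left (g t) (hf t ht)
      rw [add_mul]
      omega
    have h₄ : g t ≤ N := (Nat.le_mul_of_pos_left (g t) (hf t ht)).trans (h t ht)
    obtain ⟨r, rfl⟩ : ∃ r, s = r + 1 := ⟨s - 1, by omega⟩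
    obtain ⟨m, rfl⟩ : ∃ m, c = m + 1 := ⟨c - 1, by omega⟩
    rw [← Finset.mul_prod_erase T _ ht]
    calc (f t + 1) * (∏ t ∈ T.erase t, (f t + 1)) * (1 + ∑ t ∈ T, g t) ^ (r + 1)
        ≤ (f t + 1) * (2 * N) ^ m * ((m + 1 + 1) * g t) ^ (r + 1) := by
          gcongr
          exact h₂
      _ = ((f t + 1) * g t) * (g t) ^ r * ((2 * N) ^ m * (m + 1 + 1) ^ (r + 1)) := by
          rw [mul_pow (m + 1 + 1)]; ring
      _ ≤ (2 * N) * N ^ r * ((2 * N) ^ m * (m + 1 + 1) ^ (r + 1)) := by gcongr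
      _ = (m + 1 + 1) ^ (r + 1) * 2 ^ (m + 1) * N ^ (r + m + 1) := by ring
      _ ≤ (m + 1 + 1) ^ (r + 1) * 2 ^ (m + 1) * N ^ ((r + 1) * (m + 1)) := by
          refine Nat.mul_le_mul_left _ (hpow _ ?_)
          have : (r + 1) * (m + 1) = r * m + r + m + 1 := by ring
          omega

/-- A set that contains the states of the parking spots in all reachable configurations. -/
def spotOptions (T : Finset Bus) : Finset (Option Bus) :=
  insert none (T.biUnion fun t => (Finset.Icc 1 t.2).image fun k => some (t.1, k))

theorem card_spotOptions_le (T : Finset Bus) : #(spotOptions T) ≤ 1 + ∑ t ∈ T, (t.2 : ℕ) := by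
  refine (Finset.card_insert_le _ _).trans ?_
  rw [add_comm]
  gcongr
  refine Finset.card_biUnion_le.trans (Finset.sum_le_sum fun t _ => ?_)
  refine Finset.card_image_le.trans ?_
  simp

theorem card_labels_toFinset_le {s c v : ℕ} {C : Config s} (hC : C ∈ classA s c v) :
    #C.labels.toFinset ≤ c * v := by
  simp only [classA, Set.mem_iUnion] at hC
  obtain ⟨V, ⟨-, hV⟩, ⟨hc, hcap⟩, -⟩ := hC
  have hmem : ∀ b ∈ C.labels, ∃ u, C.graph.label u = b := by
    intro b hb
    simpa [Config.labels, List.mem_ofFn] using hb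
  have h₁ : #(C.labels.toFinset.image Prod.fst) ≤ c := by
    have : ((C.labels.toFinset.image Prod.fst : Finset Color) : Set Color) ⊆ C.colors := by
      intro x hx
      simp only [coe_image, Set.mem_image, mem_coe, Multiset.mem_toFinset] at hx
      obtain ⟨b, hb, rfl⟩ := hx
      obtain ⟨u, rfl⟩ := hmem b hb
      exact Or.inr (Or.inl ⟨u, rfl⟩)
    have := (Set.encard_le_encard this).trans hc
    rw [Set.encard_coe_eq_coe_finsetCard] at this
    exact_mod_cast this
  have h₂ : #(C.labels.toFinset.image Prod.snd) ≤ v := by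
    have : ((C.labels.toFinset.image Prod.snd : Finset ℕ+) : Set ℕ+) ⊆ V := by
      intro x hx
      simp only [coe_image, Set.mem_image, mem_coe, Multiset.mem_toFinset] at hx
      obtain ⟨b, hb, rfl⟩ := hx
      obtain ⟨u, rfl⟩ := hmem b hb
      exact hcap u
    have := (Set.encard_le_encard this).trans hV
    rw [Set.encard_coe_eq_coe_finsetCard] at this
    exact_mod_cast this
  calc #C.labels.toFinset
      ≤ #(C.labels.toFinset.image Prod.fst ×ˢ C.labels.toFinset.image Prod.snd) := by
        refine Finset.card_le_card fun b hb => ?_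
        exact Finset.mem_product.2 ⟨Finset.mem_image_of_mem _ hb, Finset.mem_image_of_mem _ hb⟩
    _ ≤ c * v := by rw [Finset.card_product]; exact Nat.mul_le_mul h₁ h₂

/-- A finite set that contains the traffic and the parking spots of all reachable
configurations. -/
def reachableStates {s : ℕ} (C : Config s) : Finset (Multiset Bus × SpotState s) :=
  Finset.Iic C.labels ×ˢ Fintype.piFinset fun _ => spotOptions C.labels.toFinset

theorem mem_reachableStates {s : ℕ} {C D : Config s} (h : Config.Below C D) :
    (D.labels, D.spots) ∈ reachableStates C := by
  refine Finset.mem_product.2 ⟨Finset.mem_Iic.2 h.labels_le, Fintype.mem_piFinset.2 fun i => ?_⟩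
  simp only [spotOptions, Finset.mem_insert, Finset.mem_biUnion, Finset.mem_image]
  rcases hi : D.spots i with _ | ⟨x, k⟩
  · exact Or.inl rfl
  · obtain ⟨l, hl, hk⟩ := h.spots i x k hi
    exact Or.inr ⟨(x, l), Multiset.mem_toFinset.2 hl, k,
      Finset.mem_Icc.2 ⟨one_le, hk⟩, rfl⟩

theorem card_reachableStates_le {s c v : ℕ} (hs : 0 < s) (hc : 0 < c) (hv : 0 < v) {C : Config s}
    (hC : C ∈ classA s c v) (h : Config.Below C C) {N : ℕ} (hN : 0 < N)
    (hn : C.queue.length ≤ N) :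
    #(reachableStates C) ≤ (c * v + 1) ^ s * 2 ^ (c * v) * N ^ (s * c * v) := by
  rw [reachableStates, Finset.card_product, Multiset.card_Iic, Fintype.card_piFinset,
    Finset.prod_const, Finset.card_univ, Fintype.card_fin]
  refine (Nat.mul_le_mul_left _ (Nat.pow_le_pow_left (card_spotOptions_le _) s)).trans ?_
  rw [mul_assoc s c v]
  refine prod_succ_mul_pow_le _ _ _ s (c * v) N hs (Nat.mul_pos hc hv) hN
    (card_labels_toFinset_le hC) (fun b hb => ?_) (fun b _ => b.2.pos) fun b _ => ?_
  · exact Multiset.count_pos.2 (Multiset.mem_toFinset.1 hb)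
  · exact (C.count_mul_le b).trans (h.seats.trans_le hn)

theorem Config.edge_eq_false_of_step {s : ℕ} {C D : Config s} (h : Step C D)
    (hC : ∀ u w, C.graph.edge u w = false) : ∀ u w, D.graph.edge u w = false := by
  cases h with
  | dispatch G Q S u i => exact fun w w' => hC _ _
  | board => exact hC
  | boardLast => exact hC

theorem Config.edge_eq_false_of_reaches {s : ℕ} {C D : Config s} (h : C.Reaches D)
    (hC : ∀ u w, C.graph.edge u w = false) : ∀ u w, D.graph.edge u w = false := by
  induction h with
  | refl => exact hC
  | tail _ hstep ih => exact Config.edge_eq_false_of_step hstep ih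

theorem edge_eq_false_of_mem_classA {s c v : ℕ} {C : Config s} (hC : C ∈ classA s c v) :
    ∀ u w, C.graph.edge u w = false := by
  simp only [classA, Set.mem_iUnion] at hC
  obtain ⟨V, -, -, h⟩ := hC
  exact h

/-- The map `g` picks some reachable configuration with the given traffic and spots. All of them are
isomorphic, because their queues agree and their graphs have no edges. The value of `g` at other
pairs is immaterial. -/
theorem encard_reachableClasses_le {s c v : ℕ} (C : Instance (classA s c v)) :
    C.1.reachableClasses.encard ≤ (#(reachableStates C.1) : ℕ∞) := by
  obtain ⟨C, hC, he, hs⟩ := C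
  classical
  let g : Multiset Bus × SpotState s → Quotient (Config.isoSetoid s) := fun p =>
    if h : ∃ D, C.Reaches D ∧ (D.labels, D.spots) = p then Quotient.mk _ h.choose
    else Quotient.mk _ C
  have hsub : C.reachableClasses ⊆ g '' (reachableStates C : Set _) := by
    rintro _ ⟨D, hD, rfl⟩
    refine ⟨(D.labels, D.spots), mem_reachableStates (.of_reaches he hs hD), ?_⟩
    have h : ∃ E, C.Reaches E ∧ (E.labels, E.spots) = (D.labels, D.spots) := ⟨D, hD, rfl⟩
    simp only [g, dif_pos h]
    obtain ⟨hE, heq⟩ := h.choose_spec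
    generalize h.choose = E at hE heq
    simp only [Prod.mk.injEq] at heq
    refine Quotient.sound ?_
    obtain ⟨e, hl⟩ := Config.exists_equiv_of_labels_eq heq.1
    refine ⟨⟨e, hl, fun u w => ?_⟩, (Config.Below.of_reaches he hs hE).queue_eq
      (.of_reaches he hs hD) heq.1 heq.2, heq.2⟩
    rw [Config.edge_eq_false_of_reaches hE (edge_eq_false_of_mem_classA hC),
      Config.edge_eq_false_of_reaches hD (edge_eq_false_of_mem_classA hC)]
  refine (Set.encard_le_encard hsub).trans ((Set.encard_image_le _ _).trans ?_)
  rw [Set.encard_coe_eq_coe_finsetCard]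

end BusOut

namespace BusOut

open Computability Enc

/-! ### The algorithm -/

/-- Words for colors. -/
abbrev Word : Type := List Bool

/-- A bus: a word for its color and its number of remaining seats minus one. -/
abbrev WBus : Type := Word × ℕ

/-- A state of the search: the traffic, the queue, and the parking spots. -/
abbrev WState : Type := List WBus × List Word × List (Option WBus)

instance : DecidableEq WBus := inferInstanceAs (DecidableEq (Word × ℕ))

instance : DecidableEq (List Word × List (Option WBus)) :=
  @instDecidableEqProd _ _ inferInstance inferInstance

instance : DecidableEq WState := @instDecidableEqProd _ _ inferInstance inferInstance

/-- The bus after a passenger has taken a seat. -/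
def WBus.board (b : WBus) : Option WBus :=
  match b.2 with
  | 0 => none
  | k + 1 => some (b.1, k)

/-- The transitions where a passenger boards the bus at the spot `i`. -/
def boardAt (i : ℕ) (S : WState) : List WState :=
  match S.2.1 with
  | [] => []
  | x :: Q => match S.2.2[i]? with
    | none => []
    | some b => match b with
      | none => []
      | some b => if b.1 = x then [(S.1, Q, S.2.2.set i b.board)] else []

/-- The transitions where a bus is dispatched to the spot `i`. -/
def dispatchAt (i : ℕ) (S : WState) : List WState :=
  match S.2.2[i]? with
  | none => []
  | some b => match b with
    | none => S.1.map fun b => (S.1.erase b, S.2.1, S.2.2.set i (some b))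
    | some _ => []

/-- All transitions. -/
def successors (s : ℕ) (S : WState) : List WState :=
  if ((List.range s).flatMap fun i => boardAt i S) = [] then
    (List.range s).flatMap fun i => dispatchAt i S
  else (List.range s).flatMap fun i => boardAt i S

/-- The states that are reachable in one step from a state of the list. -/
def nextLevel (s : ℕ) (L : List WState) : List WState :=
  nub (L.flatMap fun S => successors s S)

/-- The number with the given binary digits, the lowest one first. -/
def bitsToNat (w : Word) : ℕ :=
  w.reverse.foldl (fun n b => (if b = true then 1 else 0) + (n + n)) 0

/-- The state of the parser: the entry that is being read, and the lists. -/
abbrev PState : Type := List Word × List (List (List Word))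

/-- Read one symbol. -/
def parseStep (S : PState) (x : Γ') : PState :=
  if x = .bit true then ((true :: S.1.headD []) :: S.1.tail, S.2)
  else if x = .bit false then ((false :: S.1.headD []) :: S.1.tail, S.2)
  else if x = .comma then ([] :: S.1, S.2)
  else if x = .bra then ([], (S.1 :: S.2.headD []) :: S.2.tail)
  else if x = .ket then (S.1, [] :: S.2)
  else S

/-- Read a string from its end. -/
def parse (w : List Γ') : List (List (List Word)) := (w.reverse.foldl parseStep ([], [])).2

/-- The bus described by an entry. -/
def entryBus (e : List Word) : WBus := (e.headD [], bitsToNat (e.tail.headD []) - 1)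

/-- The initial state of the search. -/
def initialState (s : ℕ) (w : List Γ') : WState :=
  (((parse w).headD []).map entryBus,
    ((parse w).tail.tail.headD []).map (fun e => e.headD []), List.replicate s none)

/-- A list whose length is the number of steps until the station is empty. -/
def stepList (S : WState) : List Word := S.1.map Prod.fst ++ S.2.1

/-- The states that are reachable in the number of steps given by the length of a list. -/
def levels (s : ℕ) (S : WState) (l : List Word) : List WState :=
  l.foldl (fun L _ => nextLevel s L) [S]

/-! ### Polynomial time for the transitions and the parser. -/

namespace PolyTime

variable {α : Type} [Enc α]

theorem wbusBoard : PolyTime WBus.board :=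
  snd.nat_cases (const none) ((fst.comp fst).pair snd).optionSome
    (fun x h => by simp only [WBus.board]; rw [h])
    fun x n h => by simp only [WBus.board]; rw [h]

theorem boardAt (i : ℕ) : PolyTime (boardAt i) := by
  have h₀ : PolyTime fun p : (WState × Word × List Word) × WBus =>
      (p.1.1.1, p.1.2.2, p.1.1.2.2.set i p.2.board) :=
    (fst.comp (fst.comp fst)).pair ((snd.comp (snd.comp fst)).pair
      (set (snd.comp (snd.comp (fst.comp fst))) (wbusBoard.comp snd) i))
  have h₁ : PolyTime fun p : (WState × Word × List Word) × WBus =>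
      if p.2.1 = p.1.2.1 then [(p.1.1.1, p.1.2.2, p.1.1.2.2.set i p.2.board)] else [] :=
    ite (decide_eq (fst.comp snd) (fst.comp (snd.comp fst))) (h₀.cons (const [])) (const [])
  have h₂ : PolyTime fun p : (WState × Word × List Word) × Option WBus =>
      match p.2 with
      | none => []
      | some b => if b.1 = p.1.2.1 then [(p.1.1.1, p.1.2.2, p.1.1.2.2.set i b.board)] else [] :=
    snd.option_cases (const []) (h₁.comp ((fst.comp fst).pair snd))
      (fun p h => by rw [h]) fun p b h => by rw [h]
  have h₃ : PolyTime fun p : WState × Word × List Word =>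
      match p.1.2.2[i]? with
      | none => []
      | some b => match b with
        | none => []
        | some b => if b.1 = p.2.1 then [(p.1.1, p.2.2, p.1.2.2.set i b.board)] else [] :=
    (getElem? (snd.comp (snd.comp fst)) i).option_cases (const []) h₂
      (fun p h => by rw [h]) fun p b h => by rw [h]
  exact (fst.comp snd).list_cases (const []) h₃
    (fun p h => by simp only [BusOut.boardAt]; rw [h])
    fun p b t h => by simp only [BusOut.boardAt]; rw [h]

theorem dispatchAt (i : ℕ) : PolyTime (dispatchAt i) := by
  have h₁ : PolyTime fun S : WState =>
      S.1.map fun b => (S.1.erase b, S.2.1, S.2.2.set i (some b)) :=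
    map fst ((erase (fst.comp fst) snd).pair ((fst.comp (snd.comp fst)).pair
      (set (snd.comp (snd.comp fst)) snd.optionSome i)))
  have h₂ : PolyTime fun p : WState × Option WBus =>
      match p.2 with
      | none => p.1.1.map fun b => (p.1.1.erase b, p.1.2.1, p.1.2.2.set i (some b))
      | some _ => [] :=
    snd.option_cases (h₁.comp fst) (const []) (fun p h => by rw [h]) fun p b h => by rw [h]
  exact (getElem? (snd.comp snd) i).option_cases (const []) h₂
    (fun p h => by simp only [BusOut.dispatchAt]; rw [h])
    fun p b h => by simp only [BusOut.dispatchAt]; rw [h]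

theorem successors (s : ℕ) : PolyTime (successors s) :=
  ite (decide_eq (range_flatMap boardAt s) (const [])) (range_flatMap dispatchAt s)
    (range_flatMap boardAt s)

theorem nextLevel (s : ℕ) : PolyTime (nextLevel s) :=
  nub (flatMap id ((successors s).comp snd))

/-- For arbitrary states the levels could grow exponentially, so the size bound on all prefixes is a
hypothesis; for instances it comes from the counting argument. -/
theorem levels (s : ℕ) {f : α → WState} {l : α → List Word} (hf : PolyTime f) (hl : PolyTime l)
    {B : ℕ → ℕ} (hB : PolyBdd B)
    (hb : ∀ x l₁ l₂, l x = l₁ ++ l₂ → sz (BusOut.levels s (f x) l₁) ≤ B (sz x)) :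
    PolyTime fun x => BusOut.levels s (f x) (l x) :=
  foldl hl (hf.cons (const [])) ((nextLevel s).comp (fst.comp snd)) hB hb

theorem parseStep : PolyTime fun p : PState × Γ' => parseStep p.1 p.2 := by
  have hbit : ∀ b, PolyTime fun p : PState × Γ' => (b :: p.1.1.headD []) :: p.1.1.tail := fun b =>
    ((const b).cons ((fst.comp fst).headD [])).cons (fst.comp fst).tail
  have hs : PolyTime fun p : PState × Γ' => p.1.2 := snd.comp fst
  have hc : ∀ x, PolyTime fun p : PState × Γ' => decide (p.2 = x) := fun x =>
    decide_eq snd (const x)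
  exact ite (hc _) ((hbit true).pair hs) <| ite (hc _) ((hbit false).pair hs) <|
    ite (hc _) (((const []).cons (fst.comp fst)).pair hs) <|
    ite (hc _) ((const []).pair (((fst.comp fst).cons (hs.headD [])).cons hs.tail)) <|
    ite (hc _) ((fst.comp fst).pair ((const []).cons hs)) fst

theorem sz_parseStep_le (S : PState) (x : Γ') : sz (BusOut.parseStep S x) ≤ sz S + 8 := by
  obtain ⟨e, l⟩ := S
  have h₁ : ∀ b : Bool, sz ((b :: e.headD []) :: e.tail) ≤ sz e + 7 := by
    intro b
    have := sz_bool b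
    cases e <;> simp <;> omega
  have h₂ : sz ((e :: l.headD []) :: l.tail) + 1 ≤ sz l + sz e + 5 := by
    cases l <;> simp; omega
  have h₃ := h₁ true
  have h₄ := h₁ false
  simp only [BusOut.parseStep]
  split_ifs <;> simp only [sz_pair, sz_nil, sz_cons] at * <;> omega

theorem parse {f : α → List Γ'} (hf : PolyTime fun x => (f x).reverse) :
    PolyTime fun x => parse (f x) :=
  snd.comp (foldl_add hf (const ([], [])) (parseStep.comp snd) (G := fun _ => 8) (.const 8)
    monotone_const fun _ S x => sz_parseStep_le S x)

end PolyTime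

end BusOut

namespace BusOut

open Computability Enc

/-! ### Correctness of the algorithm -/

theorem encodeNat_injective : Function.Injective encodeNat :=
  Function.LeftInverse.injective decode_encodeNat

/-- The word form of a bus. -/
def wbus (b : Bus) : WBus := (encodeNat b.1, b.2.natPred)

theorem board_wbus_add_one (x : Color) (k : ℕ+) :
    (wbus (x, k + 1)).board = some (wbus (x, k)) := by
  have : (k + 1).natPred = k.natPred + 1 := by
    have := k.pos
    simp only [PNat.natPred, PNat.add_coe, PNat.val_ofNat]
    omega
  simp only [wbus, WBus.board]
  rw [this]

theorem board_wbus_one (x : Color) : (wbus (x, 1)).board = none := rfl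

theorem mem_boardAt {i : ℕ} {S T : WState} : T ∈ boardAt i S ↔ ∃ x Q k, S.2.1 = x :: Q ∧
    S.2.2[i]? = some (some (x, k)) ∧ T = (S.1, Q, S.2.2.set i (WBus.board (x, k))) := by
  obtain ⟨B, Q, P⟩ := S
  simp only [boardAt]
  constructor
  · intro h
    rcases Q with _ | ⟨x, Q⟩
    · simp at h
    · rcases hi : P[i]? with _ | _ | ⟨y, k⟩
      · simp [hi] at h
      · simp [hi] at h
      · simp only [hi] at h
        split_ifs at h with hxy
        · subst hxy
          exact ⟨y, Q, k, rfl, rfl, by simpa using h⟩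
        · simp at h
  · rintro ⟨x, R, k, rfl, hi, rfl⟩
    simp [hi]

theorem mem_dispatchAt {i : ℕ} {S T : WState} : T ∈ dispatchAt i S ↔ S.2.2[i]? = some none ∧
    ∃ b ∈ S.1, T = (S.1.erase b, S.2.1, S.2.2.set i (some b)) := by
  obtain ⟨B, Q, P⟩ := S
  simp only [dispatchAt]
  rcases hi : P[i]? with _ | _ | b
  · simp
  · simp [eq_comm]
  · simp

/-- The state of the search stands for the configuration. -/
structure Sim {s : ℕ} (C : Config s) (S : WState) : Prop where
  perm : ((List.ofFn C.graph.label).map wbus).Perm S.1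
  queue : S.2.1 = C.queue.map encodeNat
  spots : S.2.2 = (List.ofFn C.spots).map (Option.map wbus)

section

variable {s : ℕ}

theorem map_ofFn_getElem? {α β : Type} (f : Fin s → α) (g : α → β) (i : Fin s) :
    ((List.ofFn f).map g)[(i : ℕ)]? = some (g (f i)) := by
  simp

theorem map_ofFn_set {α β : Type} (f : Fin s → α) (g : α → β) (i : Fin s) (y : α) :
    ((List.ofFn f).map g).set i (g y) = (List.ofFn (Function.update f i y)).map g := by
  refine List.ext_getElem (by simp) fun j h₁ h₂ => ?_
  simp only [List.getElem_set, List.getElem_map, List.getElem_ofFn]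
  by_cases h : (i : ℕ) = j
  · subst h; simp
  · rw [if_neg h, Function.update_of_ne]
    intro e
    exact h (by rw [← e])

theorem Sim.lt_of_getElem? {C : Config s} {S : WState} (h : Sim C S) {i : ℕ} {y : Option WBus}
    (hi : S.2.2[i]? = some y) : ∃ hs : i < s, (C.spots ⟨i, hs⟩).map wbus = y := by
  obtain ⟨h₁, h₂⟩ := List.getElem?_eq_some_iff.1 hi
  have hs : i < s := by simpa [h.spots] using h₁
  refine ⟨hs, ?_⟩
  have := map_ofFn_getElem? C.spots (Option.map wbus) ⟨i, hs⟩
  rw [← h.spots, hi] at this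
  exact (Option.some.inj this).symm

theorem Sim.boardAt_of_spot {C : Config s} {S : WState} (h : Sim C S) {x : Color} {Q : List Color}
    {i : Fin s} {k : ℕ+} (hq : C.queue = x :: Q) (hi : C.spots i = some (x, k)) :
    (S.1, Q.map encodeNat, S.2.2.set i (WBus.board (wbus (x, k)))) ∈ boardAt i S := by
  refine mem_boardAt.2 ⟨encodeNat x, Q.map encodeNat, k.natPred, ?_, ?_, rfl⟩
  · rw [h.queue, hq]; rfl
  · rw [h.spots, map_ofFn_getElem?, hi]; rfl

theorem mem_successors_of_mem_boardAt {S T : WState} (i : Fin s) (h : T ∈ boardAt i S) :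
    T ∈ successors s S := by
  have hm : T ∈ (List.range s).flatMap fun i => boardAt i S :=
    List.mem_flatMap.2 ⟨i, List.mem_range.2 i.2, h⟩
  rw [successors, if_neg (List.ne_nil_of_mem hm)]
  exact hm

theorem Sim.canBoard {C : Config s} {S : WState} (h : Sim C S)
    (hb : ((List.range s).flatMap fun i => boardAt i S) ≠ []) : CanBoard C.queue C.spots := by
  obtain ⟨T, hT⟩ := List.exists_mem_of_ne_nil _ hb
  obtain ⟨i, -, hT⟩ := List.mem_flatMap.1 hT
  obtain ⟨x, Q, k, hq, hi, -⟩ := mem_boardAt.1 hT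
  obtain ⟨hs, hi⟩ := h.lt_of_getElem? hi
  rw [h.queue] at hq
  obtain ⟨⟨y, l⟩, hy, he⟩ := Option.map_eq_some_iff.1 hi
  simp only [wbus, Prod.mk.injEq] at he
  rcases hC : C.queue with _ | ⟨z, R⟩
  · simp [hC] at hq
  · simp only [hC, List.map_cons, List.cons.injEq] at hq
    refine ⟨z, by simp, ⟨i, hs⟩, l, ?_⟩
    rw [hy, encodeNat_injective (he.1.trans hq.1.symm)]

/-- The search erases the first bus with the right label, whereas `remove` renumbers the vertices
other than `u`; this is why `Sim` compares traffic only up to permutation. -/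
theorem Sim.successor_of_step {C D : Config s} {S : WState} (h : Sim C S) (hs : Step C D) :
    ∃ T ∈ successors s S, Sim D T := by
  cases hs with
  | @dispatch m G Q P u i hfree hspot hwait =>
    obtain ⟨hp, hq, hsp⟩ := h
    have hperm : (wbus (G.label u) :: (List.ofFn (G.remove u).label).map wbus).Perm S.1 := by
      have := Multiset.coe_eq_coe.1 (by simpa using G.cons_labels_remove u :
        ((G.label u :: List.ofFn (G.remove u).label : List Bus) : Multiset Bus) = List.ofFn G.label)
      exact (this.map wbus).trans hp
    refine ⟨(S.1.erase (wbus (G.label u)), S.2.1, S.2.2.set i (some (wbus (G.label u)))), ?_,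
      ⟨?_, hq, ?_⟩⟩
    · rw [successors, if_pos]
      · refine List.mem_flatMap.2 ⟨i, List.mem_range.2 i.2, mem_dispatchAt.2 ⟨?_, _, ?_, rfl⟩⟩
        · rw [hsp, map_ofFn_getElem?]; exact congrArg (fun y => some (Option.map wbus y)) hspot
        · exact hperm.subset (by simp)
      · by_contra hb
        exact hwait (Sim.canBoard (C := ⟨m + 1, G, Q, P⟩) ⟨hp, hq, hsp⟩ hb)
    · simpa using hperm.erase (wbus (G.label u))
    · simp only [hsp]
      exact map_ofFn_set P (Option.map wbus) i (some (G.label u))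
  | @board m G x Q P i k hspot =>
    refine ⟨_, mem_successors_of_mem_boardAt i (h.boardAt_of_spot rfl hspot), ⟨h.perm, rfl, ?_⟩⟩
    simp only [board_wbus_add_one, h.spots]
    exact map_ofFn_set P (Option.map wbus) i (some (x, k))
  | @boardLast m G x Q P i hspot =>
    refine ⟨_, mem_successors_of_mem_boardAt i (h.boardAt_of_spot rfl hspot), ⟨h.perm, rfl, ?_⟩⟩
    simp only [board_wbus_one, h.spots]
    exact map_ofFn_set P (Option.map wbus) i none

theorem successors_cases {S T : WState} (hT : T ∈ successors s S) :
    (∃ i, T ∈ boardAt i S) ∨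
      (((List.range s).flatMap fun i => boardAt i S) = [] ∧ ∃ i, T ∈ dispatchAt i S) := by
  rw [successors] at hT
  split_ifs at hT with hb
  · obtain ⟨i, -, hT⟩ := List.mem_flatMap.1 hT
    exact Or.inr ⟨hb, i, hT⟩
  · obtain ⟨i, -, hT⟩ := List.mem_flatMap.1 hT
    exact Or.inl ⟨i, hT⟩

/-- The search dispatches any bus of its list without looking at a graph. This is legitimate because
without edges every bus is free. -/
theorem Sim.step_of_successor {C : Config s} {S T : WState} (h : Sim C S)
    (hE : ∀ u w, C.graph.edge u w = false) (hT : T ∈ successors s S) :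
    ∃ D, Step C D ∧ Sim D T := by
  obtain ⟨m, G, R, P⟩ := C
  rcases successors_cases hT with ⟨i, hT⟩ | ⟨hb, i, hT⟩
  · obtain ⟨x, Q, k, hq, hi, rfl⟩ := mem_boardAt.1 hT
    obtain ⟨his, hi⟩ := h.lt_of_getElem? hi
    obtain ⟨⟨y, l⟩, hy, he⟩ := Option.map_eq_some_iff.1 hi
    rw [h.queue] at hq
    rcases R with _ | ⟨z, R⟩
    · simp at hq
    · simp only [List.map_cons, List.cons.injEq] at hq
      obtain ⟨hz, rfl⟩ := hq
      have hyz : y = z := by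
        simp only [wbus, Prod.mk.injEq] at he
        exact encodeNat_injective (he.1.trans hz.symm)
      subst hyz
      rw [← he]
      by_cases hl : l = 1
      · subst hl
        refine ⟨_, .boardLast G y R P ⟨i, his⟩ hy, ⟨h.perm, rfl, ?_⟩⟩
        simp only [board_wbus_one, h.spots]
        exact map_ofFn_set P (Option.map wbus) ⟨i, his⟩ none
      · obtain ⟨k', rfl⟩ := PNat.exists_eq_succ_of_ne_one hl
        refine ⟨_, .board G y R P ⟨i, his⟩ k' hy, ⟨h.perm, rfl, ?_⟩⟩
        simp only [board_wbus_add_one, h.spots]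
        exact map_ofFn_set P (Option.map wbus) ⟨i, his⟩ (some (y, k'))
  · obtain ⟨hi, b, hbm, rfl⟩ := mem_dispatchAt.1 hT
    obtain ⟨his, hi⟩ := h.lt_of_getElem? hi
    have hbm' := h.perm.symm.subset hbm
    simp only [List.mem_map, List.mem_ofFn] at hbm'
    obtain ⟨_, ⟨u, rfl⟩, rfl⟩ := hbm'
    rcases m with _ | m
    · exact u.elim0
    have hno : ¬ CanBoard R P := by
      rintro ⟨x, hx, j, k, hj⟩
      rcases R with _ | ⟨z, R⟩
      · simp at hx
      · obtain rfl : z = x := by simpa using hx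
        have := h.boardAt_of_spot (Q := R) rfl hj
        have hm := List.mem_flatMap (f := fun i => boardAt i S).2
          ⟨(j : ℕ), List.mem_range.2 j.2, this⟩
        rw [hb] at hm
        simp at hm
    have hstep := Step.dispatch G R P u ⟨i, his⟩ (hE u) (by simpa using hi) hno
    refine ⟨_, hstep, ?_⟩
    have hperm : (wbus (G.label u) :: (List.ofFn (G.remove u).label).map wbus).Perm S.1 := by
      have := Multiset.coe_eq_coe.1 (by simpa using G.cons_labels_remove u :
        ((G.label u :: List.ofFn (G.remove u).label : List Bus) : Multiset Bus) = List.ofFn G.label)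
      exact (this.map wbus).trans h.perm
    refine ⟨by simpa using hperm.erase (wbus (G.label u)), h.queue, ?_⟩
    simp only [h.spots]
    exact map_ofFn_set P (Option.map wbus) ⟨i, his⟩ (some (G.label u))

/-! ### Traffic lists determined by their multisets. -/

/-- The list `B` arises from `B₀` by erasing elements one after the other. -/
def ErasedFrom (B₀ B : List WBus) : Prop := ∃ M, (M ++ B).Perm B₀ ∧ B = B₀.diff M

theorem ErasedFrom.erase {B₀ B : List WBus} (h : ErasedFrom B₀ B) {b : WBus} (hb : b ∈ B) :
    ErasedFrom B₀ (B.erase b) := by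
  obtain ⟨M, h₁, h₂⟩ := h
  refine ⟨M ++ [b], ?_, ?_⟩
  · rw [List.append_assoc]
    exact (List.Perm.append_left M (List.perm_cons_erase hb).symm).trans h₁
  · rw [List.diff_append, ← h₂]
    simp

/-- What remains determines the erased elements up to order, and `List.diff` does not depend on that
order. Hence removing duplicate lists also merges states with the same multiset of buses. -/
theorem ErasedFrom.eq_of_perm {B₀ B B' : List WBus} (h : ErasedFrom B₀ B) (h' : ErasedFrom B₀ B')
    (hp : B.Perm B') : B = B' := by
  obtain ⟨M, h₁, rfl⟩ := h
  obtain ⟨M', h₂, rfl⟩ := h'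
  have : (M ++ B₀.diff M').Perm (M' ++ B₀.diff M') :=
    ((List.Perm.append_left M hp).symm.trans h₁).trans h₂.symm
  exact List.Perm.diff_left _ ((List.perm_append_right_iff _).1 this)

theorem ErasedFrom.sublist {B₀ B : List WBus} (h : ErasedFrom B₀ B) : B.Sublist B₀ := by
  obtain ⟨M, -, rfl⟩ := h
  exact List.diff_sublist _ _

theorem successors_erasedFrom {B₀ : List WBus} {S T : WState} (hT : T ∈ successors s S)
    (h : ErasedFrom B₀ S.1) : ErasedFrom B₀ T.1 := by
  rcases successors_cases hT with ⟨i, hT⟩ | ⟨-, i, hT⟩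
  · obtain ⟨x, Q, k, -, -, rfl⟩ := mem_boardAt.1 hT
    exact h
  · obtain ⟨-, b, hb, rfl⟩ := mem_dispatchAt.1 hT
    exact h.erase hb

/-! ### The levels of the search. -/

/-- The number of steps that remain. -/
def Config.remaining (C : Config s) : ℕ := C.size + C.queue.length

theorem Config.remaining_of_step {C D : Config s} (h : Step C D) :
    D.remaining + 1 = C.remaining := by
  cases h <;> simp [Config.remaining] <;> omega

theorem levels_append (S : WState) (l : List Word) (x : Word) :
    levels s S (l ++ [x]) = nextLevel s (levels s S l) := by
  simp [levels]

/-- The list `l` is only a clock: its length is the number of steps made, and each step lowers the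
remaining number by one. -/
theorem levels_sound {C : Config s} {S : WState} (h : Sim C S)
    (hE : ∀ u w, C.graph.edge u w = false) (l : List Word) :
    ∀ T ∈ levels s S l, ErasedFrom S.1 T.1 ∧
      ∃ D, C.Reaches D ∧ Sim D T ∧ D.remaining + l.length = C.remaining := by
  induction l using List.reverseRecOn with
  | nil =>
    intro T hT
    obtain rfl : T = S := by simpa [levels] using hT
    exact ⟨⟨[], by simp, by simp⟩, C, .refl, h, rfl⟩
  | append_singleton l x ih =>
    intro T hT
    rw [levels_append, nextLevel, (nub_spec _).2, List.mem_flatMap] at hT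
    obtain ⟨R, hR, hT⟩ := hT
    obtain ⟨he, D, hD, hsim, hrem⟩ := ih R hR
    obtain ⟨E, hDE, hsim'⟩ :=
      hsim.step_of_successor (Config.edge_eq_false_of_reaches hD hE) hT
    refine ⟨successors_erasedFrom hT he, E, hD.tail hDE, hsim', ?_⟩
    have := Config.remaining_of_step hDE
    rw [List.length_append, List.length_singleton]
    omega

theorem levels_complete {C D : Config s} {S : WState} (h : Sim C S) (hD : C.Reaches D) :
    D.remaining ≤ C.remaining ∧ ∀ l : List Word, D.remaining + l.length = C.remaining →
      ∃ T ∈ levels s S l, Sim D T := by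
  induction hD with
  | refl =>
    refine ⟨le_rfl, fun l hl => ⟨S, ?_, h⟩⟩
    obtain rfl : l = [] := List.length_eq_zero_iff.1 (by omega)
    simp [levels]
  | @tail D E _ hDE ih =>
    have hrem := Config.remaining_of_step hDE
    refine ⟨by omega, fun l hl => ?_⟩
    rcases List.eq_nil_or_concat' l with rfl | ⟨l, x, rfl⟩
    · rw [List.length_nil] at hl; omega
    · simp only [List.length_append, List.length_cons, List.length_nil] at hl
      obtain ⟨T, hT, hsim⟩ := ih.2 l (by omega)
      obtain ⟨R, hR, hsim'⟩ := hsim.successor_of_step hDE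
      refine ⟨R, ?_, hsim'⟩
      rw [levels_append, nextLevel, (nub_spec _).2, List.mem_flatMap]
      exact ⟨T, hT, hR⟩

theorem solvable_iff_levels {C : Config s} {S : WState} (h : Sim C S)
    (hE : ∀ u w, C.graph.edge u w = false) (he : C.Eligible) (hs : C.SpotsEmpty) {l : List Word}
    (hl : l.length = C.remaining) : C.Solvable ↔ levels s S l ≠ [] := by
  constructor
  · rintro ⟨D, hD, h₁, h₂, -⟩
    obtain ⟨T, hT, -⟩ := (levels_complete h hD).2 l (by simp [Config.remaining, h₁, h₂, hl])
    exact List.ne_nil_of_mem hT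
  · intro hne
    obtain ⟨T, hT⟩ := List.exists_mem_of_ne_nil _ hne
    obtain ⟨-, D, hD, -, hrem⟩ := levels_sound h hE l T hT
    have hrem' : D.size = 0 ∧ D.queue.length = 0 := by
      simp only [Config.remaining] at hrem hl
      omega
    refine ⟨D, hD, hrem'.1, List.length_eq_zero_iff.1 hrem'.2, fun i => ?_⟩
    -- With no passenger left, the invariant leaves no seat, and a parked bus would have at least
    -- one.
    have hseats := (Config.Below.of_reaches he hs hD).seats
    rw [hrem'.2, Config.totalSeats] at hseats
    have h₀ : ∑ i, Config.spotSeats (D.spots i) = 0 := by omega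
    have h₁ := (Finset.sum_eq_zero_iff.1 h₀) i (Finset.mem_univ i)
    rcases hi : D.spots i with _ | b
    · rfl
    · rw [hi] at h₁
      exact absurd h₁ b.2.ne_zero

theorem levels_nodup (S : WState) (l : List Word) : (levels s S l).Nodup := by
  induction l using List.reverseRecOn with
  | nil => simp [levels]
  | append_singleton l x => rw [levels_append]; exact (nub_spec _).1

/-- Each state of the duplicate-free level is sent to the traffic and spots of a configuration it
stands for. This is injective: the queue is determined by `queue_eq`, and the traffic list by
`ErasedFrom.eq_of_perm`. -/
theorem levels_length_le {C : Config s} {S : WState} (h : Sim C S)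
    (hE : ∀ u w, C.graph.edge u w = false) (he : C.Eligible) (hs : C.SpotsEmpty) (l : List Word) :
    (levels s S l).length ≤ (reachableStates C).card := by
  have : ∀ T, ∃ D, T ∈ levels s S l → C.Reaches D ∧ Sim D T := fun T => by
    by_cases hT : T ∈ levels s S l
    · obtain ⟨-, D, h₁, h₂, -⟩ := levels_sound h hE l T hT
      exact ⟨D, fun _ => ⟨h₁, h₂⟩⟩
    · exact ⟨C, fun h => absurd h hT⟩
  choose D hD using this
  rw [← List.toFinset_card_of_nodup (levels_nodup S l)]
  refine Finset.card_le_card_of_injOn (fun T => ((D T).labels, (D T).spots)) (fun T hT => ?_) ?_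
  · exact mem_reachableStates (.of_reaches he hs (hD T (by simpa using hT)).1)
  · intro T hT T' hT' heq
    simp only [List.coe_toFinset, Set.mem_ofPred_eq] at hT hT'
    simp only [Prod.mk.injEq] at heq
    have h₁ := (hD T hT).2
    have h₂ := (hD T' hT').2
    have hq := (Config.Below.of_reaches he hs (hD T hT).1).queue_eq
      (.of_reaches he hs (hD T' hT').1) heq.1 heq.2
    have hB : T.1 = T'.1 := by
      refine (levels_sound h hE l T hT).1.eq_of_perm (levels_sound h hE l T' hT').1 ?_
      exact (h₁.perm.symm.trans ((Multiset.coe_eq_coe.1 heq.1).map wbus)).trans h₂.perm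
    refine Prod.ext hB (Prod.ext ?_ ?_)
    · rw [h₁.queue, h₂.queue, hq]
    · rw [h₁.spots, h₂.spots, heq.2]

theorem sz_le_of_sublist {α : Type} [Enc α] {l l' : List α} (h : l.Sublist l') : sz l ≤ sz l' := by
  induction h with
  | slnil => exact le_rfl
  | cons a _ ih => simp; omega
  | cons_cons a _ ih => simp; omega

/-- The traffic is a sublist and the queue a suffix of the initial one, and a parked bus has the
color of some initial bus and no more seats than it. -/
theorem sz_le_of_mem_levels {C : Config s} {S : WState} (h : Sim C S)
    (hE : ∀ u w, C.graph.edge u w = false) (he : C.Eligible) (hs : C.SpotsEmpty) (l : List Word)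
    {T : WState} (hT : T ∈ levels s S l) : sz T ≤ sz S + s * (sz S + 3) + 1 := by
  obtain ⟨her, D, hD, hsim, -⟩ := levels_sound h hE l T hT
  have hbelow := Config.Below.of_reaches he hs hD
  have h₁ := sz_le_of_sublist her.sublist
  have h₂ : sz T.2.1 ≤ sz S.2.1 := by
    rw [hsim.queue, h.queue]
    exact sz_le_of_sublist (hbelow.suffix.sublist.map _)
  have h₃ : sz T.2.2 ≤ T.2.2.length * ((sz S.1 + 2) + 1) + 1 := by
    refine sz_le_of_forall fun b hb => ?_
    rw [hsim.spots] at hb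
    simp only [List.mem_map, List.mem_ofFn] at hb
    obtain ⟨_, ⟨i, rfl⟩, rfl⟩ := hb
    rcases hi : D.spots i with _ | ⟨x, k⟩
    · have := sz_pos S.1
      simp [sz] at this ⊢
    · obtain ⟨c, hc, hk⟩ := hbelow.spots i x k hi
      have hmem : wbus (x, c) ∈ S.1 := by
        refine h.perm.subset (List.mem_map_of_mem ?_)
        simpa [Config.labels] using hc
      have h₄ := sz_le_of_mem hmem
      have h₅ : k.natPred ≤ c.natPred := PNat.natPred_le_natPred.2 hk
      have h₆ : sz (some (wbus (x, k))) = sz (wbus (x, k)) + 2 := by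
        simp [sz]; omega
      simp only [Option.map_some, h₆]
      simp only [wbus, sz_pair, sz_nat] at h₄ ⊢
      omega
  have h₄ : T.2.2.length = s := by rw [hsim.spots]; simp
  rw [h₄] at h₃
  have h₅ : s * ((sz S.1 + 2) + 1) ≤ s * (sz S + 3) := by
    refine Nat.mul_le_mul_left _ ?_
    obtain ⟨a, b⟩ := S
    simp only [sz_pair]; omega
  obtain ⟨a, b, c⟩ := S
  obtain ⟨a', b', c'⟩ := T
  simp only [sz_pair] at *
  omega

end

end BusOut

namespace BusOut

open Computability Enc

/-! ### Reading the input -/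

theorem foldr_parse_bits (w : Word) (v : Word) (e : List Word) (l : List (List (List Word))) :
    (w.map Γ'.bit).foldr (fun x S => parseStep S x) (v :: e, l) = ((w ++ v) :: e, l) := by
  induction w with
  | nil => rfl
  | cons b w ih =>
    rw [List.map_cons, List.foldr_cons, ih]
    cases b <;> simp [parseStep]

/-- Read from the end, the comma comes first and opens an empty word, in front of which the digits
are then put in the right order. -/
theorem foldr_parse_encNat (n : ℕ) (e : List Word) (l : List (List (List Word))) :
    (encNat n).foldr (fun x S => parseStep S x) (e, l) = (encodeNat n :: e, l) := by
  rw [encNat, List.foldr_append]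
  have : [Γ'.comma].foldr (fun x S => parseStep S x) (e, l) = ([] :: e, l) := by
    simp [parseStep]
  rw [this, foldr_parse_bits, List.append_nil]

/-- Read from the end, `ket` opens an empty list, and each `bra` stores the entry just completed and
starts a new one. -/
theorem foldr_parse_encList {α : Type} (f : α → List Γ') (g : α → List Word) (L : List α)
    (hf : ∀ a ∈ L, ∀ l, (f a).foldr (fun x S => parseStep S x) ([], l) = (g a, l))
    (l : List (List (List Word))) :
    (encList f L).foldr (fun x S => parseStep S x) ([], l) = ([], L.map g :: l) := by
  induction L with
  | nil => simp [encList, parseStep]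
  | cons a L ih =>
    rw [encList, List.foldr_cons, List.foldr_append, ih fun b hb => hf b (by simp [hb]),
      hf a (by simp)]
    simp [parseStep]

theorem parse_encode {s : ℕ} {C : Config s} (hE : ∀ u w, C.graph.edge u w = false)
    (hs : C.SpotsEmpty) :
    parse C.encode = [(List.ofFn C.graph.label).map fun b => [encodeNat b.1, encodeNat b.2], [],
      C.queue.map fun x => [encodeNat x], (List.ofFn C.spots).map fun _ => []] := by
  have hedge : C.graph.edgeList = [] := by
    simp [CongestionGraph.edgeList, hE]
  rw [parse, List.foldl_reverse, Config.encode, List.foldr_append, List.foldr_append,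
    List.foldr_append, foldr_parse_encList encSpot (fun _ => []),
    foldr_parse_encList encNat (fun x => [encodeNat x]),
    foldr_parse_encList encEdge (fun _ => []),
    foldr_parse_encList encBus (fun b => [encodeNat b.1, encodeNat b.2]), hedge]
  · rfl
  · intro b _ l
    rw [encBus, List.foldr_append, foldr_parse_encNat, foldr_parse_encNat]
  · intro p hp
    -- There is no edge, so the form of an edge entry does not matter.
    rw [hedge] at hp
    simp at hp
  · intro x _ l
    exact foldr_parse_encNat x [] l
  · intro b hb l
    rw [List.mem_ofFn] at hb
    obtain ⟨i, rfl⟩ := hb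
    -- Only empty spots occur, and the parser ignores their symbol; the bracket of a parked bus
    -- would be mistaken for the start of a list entry.
    rw [hs i]
    simp [encSpot, parseStep]

theorem bitsToNat_cons (b : Bool) (w : Word) :
    bitsToNat (b :: w) = (if b = true then 1 else 0) + (bitsToNat w + bitsToNat w) := by
  simp [bitsToNat]

theorem bitsToNat_encodeNat (n : ℕ) : bitsToNat (encodeNat n) = n := by
  have key : ∀ p : PosNum, bitsToNat (encodePosNum p) = p := by
    intro p
    induction p with
    | one => rfl
    | bit0 p ih => rw [encodePosNum, bitsToNat_cons, ih]; simp
    | bit1 p ih =>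
      rw [encodePosNum, bitsToNat_cons, ih]
      simp only [if_true, PosNum.cast_bit1]
      omega
  have h : (((n : Num) : Num) : ℕ) = n := Num.to_of_nat n
  rw [encodeNat]
  conv_rhs => rw [← h]
  cases (n : Num) with
  | zero => rfl
  | pos p => exact key p

/-- Horner's scheme never decreases, so the final value bounds all intermediate ones, as a bounded
fold requires. -/
theorem bitsToNat_prefix_le (l₁ l₂ : List Bool) (m : ℕ) :
    l₁.foldl (fun n b => (if b = true then 1 else 0) + (n + n)) m ≤
      (l₁ ++ l₂).foldl (fun n b => (if b = true then 1 else 0) + (n + n)) m := by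
  have key : ∀ (l : List Bool) (m : ℕ),
      m ≤ l.foldl (fun n b => (if b = true then 1 else 0) + (n + n)) m := by
    intro l
    induction l with
    | nil => exact fun _ => le_rfl
    | cons b l ih => exact fun m => le_trans (by dsimp only; omega) (ih _)
  rw [List.foldl_append]
  exact key _ _

theorem initialState_encode {s : ℕ} {C : Config s} (hE : ∀ u w, C.graph.edge u w = false)
    (hs : C.SpotsEmpty) : Sim C (initialState s C.encode) := by
  rw [initialState, parse_encode hE hs]
  refine ⟨List.Perm.of_eq ?_, ?_, ?_⟩
  · simp only [List.headD_cons, List.map_map]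
    refine List.map_congr_left fun b _ => ?_
    simp [entryBus, wbus, bitsToNat_encodeNat, PNat.natPred]
  · simp
  · refine List.ext_getElem (by simp) fun i h₁ h₂ => ?_
    simp [hs _]

instance {s : ℕ} : Enc (Config s) := encOfString Config.encode Config.encode_injective

/-! ### Polynomial time on instances. -/

section

variable {s c v : ℕ}

theorem edge_eq_false (x : Instance (classA s c v)) : ∀ u w, x.1.graph.edge u w = false :=
  edge_eq_false_of_mem_classA x.2.1

theorem below_self (x : Instance (classA s c v)) : Config.Below x.1 x.1 :=
  .refl x.2.2.1 x.2.2.2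

theorem sim_initialState (x : Instance (classA s c v)) : Sim x.1 (initialState s x.1.encode) :=
  initialState_encode (edge_eq_false x) x.2.2.2

theorem PolyTime.parse_encode :
    PolyTime fun x : Instance (classA s c v) => BusOut.parse x.1.encode :=
  parse (id.of_enc (fun x => x) (fun _ => rfl) fun _ => rfl)

theorem queue_length_lt_sz (x : Instance (classA s c v)) :
    x.1.queue.length < sz (((BusOut.parse x.1.encode).tail.tail.headD []).map fun e =>
      e.headD []) := by
  refine lt_of_eq_of_lt ?_ (length_le_sz _)
  rw [BusOut.parse_encode (edge_eq_false x) x.2.2.2]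
  simp

/-- Passing from binary to unary is exponential in general. Here the entries come from buses of an
eligible configuration, whose capacities are at most the number of passengers; this is why `map_mem`
is used instead of `map`. -/
theorem PolyTime.initialState :
    PolyTime fun x : Instance (classA s c v) => initialState s x.1.encode := by
  have hq : PolyTime fun x : Instance (classA s c v) =>
      ((BusOut.parse x.1.encode).tail.tail.headD []).map fun e => e.headD [] :=
    map (parse_encode.tail.tail.headD []) (snd.headD [])
  obtain ⟨k, hk⟩ := hq.exists_sz_le
  refine (map_mem (g := fun _ e => entryBus e) (parse_encode.headD []) ?_).pair (hq.pair (const _))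
  have he : PolyTime fun p : {p : Instance (classA s c v) × List Word //
      p.2 ∈ (BusOut.parse p.1.1.encode).headD []} => p.1.2 := snd.restrict _
  refine (he.headD []).pair (pred ?_)
  refine foldl (he.tail.headD []).reverse (const 0)
    (add (ite (decide_eq (snd.comp snd) (const true)) (const 1) (const 0))
      (add (fst.comp snd) (fst.comp snd)))
    -- The tree of a unary number `m` has size `2 * m + 1`, and the values are below the size of the
    -- parsed queue.
    (B := fun n => 2 * (n + (n + 2) ^ k) + 1)
    (((PolyBdd.const 2).mul (PolyBdd.id.add (.pow_self k))).add (.const 1)) ?_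
  rintro ⟨⟨x, e⟩, hmem⟩ l₁ l₂ h
  have hle := bitsToNat_prefix_le l₁ l₂ 0
  rw [← h] at hle
  have hcap : bitsToNat (e.tail.headD []) ≤ x.1.queue.length := by
    dsimp only at hmem
    rw [BusOut.parse_encode (edge_eq_false x) x.2.2.2, List.headD_cons, List.mem_map] at hmem
    obtain ⟨b, hb, rfl⟩ := hmem
    simp only [List.tail_cons, List.headD_cons, bitsToNat_encodeNat]
    have h₁ := x.1.count_mul_le b
    have h₂ : 0 < x.1.labels.count b := Multiset.count_pos.2 (by simpa [Config.labels] using hb)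
    have h₃ := (below_self x).seats
    have h₄ := Nat.le_mul_of_pos_left (b.2 : ℕ) h₂
    omega
  have h₁ := queue_length_lt_sz x
  have h₂ := hk x
  have h₃ : sz x ≤ sz (x, e) := by rw [sz_pair]; omega
  have h₄ : (sz x + 2) ^ k ≤ (sz (x, e) + 2) ^ k := by gcongr
  have h₅ : bitsToNat (e.tail.headD []) = (e.tail.headD []).reverse.foldl
    (fun n b => (if b = true then 1 else 0) + (n + n)) 0 := rfl
  dsimp only at hle
  rw [sz_nat]
  simp only [sz_sub]
  omega

theorem length_stepList (x : Instance (classA s c v)) :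
    (stepList (initialState s x.1.encode)).length = x.1.remaining := by
  have h := sim_initialState x
  have h₁ := h.perm.length_eq
  rw [stepList, h.queue, Config.remaining]
  simp only [List.length_append, List.length_map, List.length_ofFn] at h₁ ⊢
  omega

theorem PolyTime.levels_initialState (hs : 0 < s) (hc : 0 < c) (hv : 0 < v) :
    PolyTime fun x : Instance (classA s c v) =>
      BusOut.levels s (BusOut.initialState s x.1.encode)
        (stepList (BusOut.initialState s x.1.encode)) := by
  have hi : PolyTime fun x : Instance (classA s c v) => BusOut.initialState s x.1.encode :=
    initialState
  obtain ⟨k, hk⟩ := hi.exists_sz_le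
  have hl : PolyTime fun x : Instance (classA s c v) =>
      stepList (BusOut.initialState s x.1.encode) :=
    append (map (fst.comp hi) (fst.comp snd)) (fst.comp (snd.comp hi))
  have hM : PolyBdd fun n => n + (n + 2) ^ k := PolyBdd.id.add (.pow_self k)
  -- The bound is the number of reachable states times the size of a state with its list node, plus
  -- one. The same `n + (n + 2) ^ k` bounds the queue length and the size of the initial state.
  refine levels s hi hl (B := fun n => ((c * v + 1) ^ s * 2 ^ (c * v) *
      (n + (n + 2) ^ k) ^ (s * c * v)) *
      ((n + (n + 2) ^ k) + s * ((n + (n + 2) ^ k) + 3) + 1 + 1) + 1) ?_ fun x l₁ l₂ _ => ?_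
  · exact (((PolyBdd.const _).mul (hM.pow _)).mul (((hM.add ((PolyBdd.const s).mul
      (hM.add (.const 3)))).add (.const 1)).add (.const 1))).add (.const 1)
  · have hsim := sim_initialState x
    have hx := hk x
    have h₁ := levels_length_le hsim (edge_eq_false x) x.2.2.1 x.2.2.2 l₁
    have hN : x.1.queue.length ≤ sz x + (sz x + 2) ^ k := by
      have h₂ := queue_length_lt_sz x
      rw [BusOut.initialState] at hx
      simp only [sz_pair] at hx
      omega
    have h₂ := card_reachableStates_le hs hc hv x.2.1 (below_self x)
      (N := sz x + (sz x + 2) ^ k) (by have := sz_pos x; omega) hN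
    have h₃ : sz (BusOut.levels s (BusOut.initialState s x.1.encode) l₁) ≤ _ :=
      sz_le_of_forall fun T hT =>
        sz_le_of_mem_levels hsim (edge_eq_false x) x.2.2.1 x.2.2.2 l₁ hT
    refine h₃.trans ?_
    gcongr
    exact h₁.trans h₂

theorem decidableInPolyTime_solvable (hs : 0 < s) (hc : 0 < c) (hv : 0 < v) :
    DecidableInPolyTime (fun C : Instance (classA s c v) => C.1.encode)
      (fun C : Instance (classA s c v) => C.1.Solvable) := by
  refine decidableInPolyTime_of_polyTime _
    (fun x y h => Subtype.ext (Config.encode_injective h)) _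
    (fun x => if levels s (initialState s x.1.encode)
      (stepList (initialState s x.1.encode)) = [] then false else true) (fun x => ?_) ?_
  · rw [solvable_iff_levels (sim_initialState x) (edge_eq_false x) x.2.2.1 x.2.2.2
      (length_stepList x)]
    simp
  · have h : PolyTime fun x : Instance (classA s c v) =>
        if levels s (initialState s x.1.encode)
          (stepList (initialState s x.1.encode)) = [] then false else true :=
      PolyTime.ite (PolyTime.decide_eq (PolyTime.levels_initialState hs hc hv) (PolyTime.const []))
        (PolyTime.const false) (PolyTime.const true)
    -- The code of an instance as an element of a subtype is definitionally the one given by its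
    -- input string.
    exact h

end

end BusOut

theorem mainTheorem5 (s c v : ℕ) (hs : 0 < s) (hc : 0 < c) (hv : 0 < v) :
    BusOut.DecidableInPolyTime
      (fun C : BusOut.Instance (BusOut.classA s c v) => C.1.encode)
      (fun C : BusOut.Instance (BusOut.classA s c v) => C.1.Solvable) ∧
    ∃ K : ℕ, ∀ C : BusOut.Instance (BusOut.classA s c v), C.1.queue ≠ [] →
      C.1.reachableClasses.encard ≤ ((K * C.1.queue.length ^ (s * c * v) : ℕ) : ℕ∞) := by
  refine ⟨BusOut.decidableInPolyTime_solvable hs hc hv,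
    (c * v + 1) ^ s * 2 ^ (c * v), fun C hq => ?_⟩
  refine (BusOut.encard_reachableClasses_le C).trans ?_
  exact_mod_cast BusOut.card_reachableStates_le hs hc hv C.2.1 (BusOut.below_self C)
    (List.length_pos_iff.2 hq) le_rfl
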